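/- For an integer $m\ge 0$ let $$N_m(x)=\frac1{m!}\sum_{j=0}^{m+1}(-1)^j\binom{m+1}{j}(x-j)_+^m$$ be the cardinal B-spline of degree $m$ (with $x_+^0=1$ for $x\ge 0$ and $x_+^0=0$ for $x<0$). For $\delta>0$ let $S_m[\delta]$ be the set of splines of degree $m$ and minimal defect with knots at $\ell\delta$, $\ell\in\mathbb Z$: the functions $s(x)=\sum_{\gamma\in\mathbb Z}c_\gamma N_m(x/\delta+\gamma)$, $c_\gamma\in\mathbb R$, which are real polynomials of degree $\le m$ on each interval $(\delta(\ell-1),\delta\ell)$, $\ell\in\mathbb Z$, and belong to $C^{m-1}(\mathbb R)$ (no condition if $m=0$). Let $$K_j=\frac4\pi\sum_{\ell=0}^\infty\frac{(-1)^{\ell(j+1)}}{(1+2\ell)^{j+1}},\qquad j=0,1,2,\dots,$$ be the Favard constants, and let $\|\cdot\|_2\in[0,\infty]$ be the norm of $L_2(\mathbb R)$. Let $0\le k\le m$ be integers; $s^{(m)}$ is defined off the knots. **Theorem.** (a) For every real $h>0$ (in particular for every $h\in\mathbb N$) and every spline $s\in S_m[1/h]$, that is, with knots at $\ell/h$, $$\|s^{(k)}\|_2\le(\pi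 h)^k\sqrt{\frac{K_{2(m-k)+1}}{K_{2m+1}}}\;\|s\|_2. \tag{1}$$ The constant in (1) is sharp for each $m,k,h$: if $C\in\mathbb R$ is such that $\|s^{(k)}\|_2\le C\|s\|_2$ for all $s\in S_m[1/h]\cap L_2(\mathbb R)$, then $C\ge(\pi h)^k\sqrt{K_{2(m-k)+1}/K_{2m+1}}$. (b) For every integer $h\ge1$, inequality (1) also holds for all $s\in S_m[h]$, that is, with knots at $\ell h$. -/

import Mathlib

open MeasureTheory Filter Topology

noncomputable section

/-- The truncated power `x_+^m`, with `x_+^0 = 1` for `x ≥ 0` and `x_+^0 = 0` for `x < 0`. -/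
def truncPow (m : ℕ) (x : ℝ) : ℝ := if 0 ≤ x then x ^ m else 0

/-- The cardinal B-spline `N_m` of degree `m`, supported in `[0, m + 1]`. -/
def cardinalBSpline (m : ℕ) (x : ℝ) : ℝ :=
  (1 / (m.factorial : ℝ)) *
    ∑ j ∈ Finset.range (m + 2), (-1 : ℝ) ^ j * ((m + 1).choose j : ℝ) * truncPow m (x - j)

/-- Splines of degree `m` and minimal defect with knots at `l * δ`, `l ∈ ℤ`. The series is locally
finite, since `N_m` has bounded support. -/
structure IsSpline (m : ℕ) (δ : ℝ) (s : ℝ → ℝ) : Prop where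
  /-- `s` is a combination, with real coefficients, of the integer shifts of the B-spline `N_m`
  scaled to the mesh size `δ`. -/
  combination : ∃ c : ℤ → ℝ, ∀ x : ℝ, s x = ∑' γ : ℤ, c γ * cardinalBSpline m (x / δ + γ)
  /-- `s` is a real polynomial of degree at most `m` between consecutive knots. -/
  piecewise : ∀ l : ℤ, ∃ p : Polynomial ℝ, p.natDegree ≤ m ∧
    ∀ x ∈ Set.Ioo (δ * ((l : ℝ) - 1)) (δ * (l : ℝ)), s x = p.eval x
  /-- `s` is of class `C^{m-1}` (no condition when `m = 0`). -/
  smooth : ∀ r : ℕ, r < m → ContDiff ℝ r s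

/-- The space of splines of degree `m` and minimal defect with knots at `l * δ`, `l ∈ ℤ`. -/
def splineSpace (m : ℕ) (δ : ℝ) : Set (ℝ → ℝ) := {s | IsSpline m δ s}

/-- The Favard constants, as limits of partial sums
(the series for `K_0` converges only conditionally). -/
def favard (m : ℕ) : ℝ :=
  (4 / Real.pi) * limUnder atTop (fun n : ℕ =>
    ∑ l ∈ Finset.range n, (-1 : ℝ) ^ (l * (m + 1)) / (1 + 2 * (l : ℝ)) ^ (m + 1))

/-- The constant `(π h)^k √(K_{2(m-k)+1} / K_{2m+1})`, for `k ≤ m`. -/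
def bernsteinConst (m k : ℕ) (h : ℝ) : ℝ :=
  (Real.pi * h) ^ k * Real.sqrt (favard (2 * (m - k) + 1) / favard (2 * m + 1))

end

/-!
A spline of mesh size `1` is `s = ∑ c_γ N_m(· + γ)`, and off the integers its `k`-th derivative is
`∑ (Δᵏ c)_γ N_{m-k}(· + γ)` with `(Δ c)_γ = c_γ - c_{γ+1}` (`iteratedDeriv_shiftSum`). For finitely
supported `c` with symbol `C(ξ) = ∑ c_γ exp (2 π i γ ξ)`, the Fourier transform of `s` is `C` times
the `(m + 1)`-st power of the transform of the indicator of `[0, 1)`. Plancherel's theorem and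
unfolding of the integral over `ℝ` to one period give (`lintegral_shiftSum_sq`)
`‖s‖² = ∫₀¹ |C(ξ)|² W_m(ξ) dξ`, where `W_m(ξ) = (sin² (π ξ) / π²)ᵐ⁺¹ ∑_l (ξ + l)⁻²ᵐ⁻²`,
and differentiation multiplies `|C|²` by `(4 sin² (π ξ))ᵏ`. The inequality therefore reduces to a
pointwise bound for the quotient of the lattice sums with exponents `2 (m - k) + 2` and `2 m + 2`:
it is largest at `ξ = 1 / 2` (`latticeSum_mul_le`), where they are multiples of Favard constants
(`favard_odd`).

For the pointwise bound, the lattice sums are polynomials in `z = cot² (π ξ)`, each obtained, up to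
a factor, from the preceding one by the differential operator `cotOp` that represents `d²/dξ²`
(`latticeSum_eq_cotPoly`). In the basis of monomials this operator is a tridiagonal matrix with
nonnegative entries and nonnegative `2 × 2` minors, so by the Cauchy–Binet formula it preserves
monotonicity of coefficient ratios (`RatioMono.cotOp`). Consequently the quotient of consecutive
polynomials has its extremum over `z ≥ 0` at `z = 0`, that is, at `ξ = 1 / 2`.

For a general square integrable spline, the B-splines that are active on `(0, 1)` are linearly
independent there (`eq_zero_of_shiftSum_eq_zero`), so the coefficients are square summable
(`exists_tsum_coeff_sq_le`), and truncation together with Fatou's lemma extends the inequality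
(`eLpNorm_shiftSum_coeffDiff_le`). If `s` is not square integrable the right side is infinite.

The constant is sharp because the splines with symbols `|C|² = (4 sin² (π ξ))ᵖ` concentrate at the
extremal frequency `ξ = 1 / 2` as `p → ∞` (`bernsteinConst_le_of_forall`). Other mesh sizes follow
by scaling; on the mesh `h ≥ 1` scaling gives `h⁻ᵏ` in place of `hᵏ`, which is no larger.
-/

/-! ### Lattice sums and cotangent polynomials -/

/-- The lattice sum `∑_{l ∈ ℤ} (t + l)⁻ᵏ`; a term with `t + l = 0` counts as `0`. -/
noncomputable def latticeSum (k : ℕ) (t : ℝ) : ℝ := ∑' l : ℤ, ((t + l) ^ k)⁻¹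

lemma summable_inv_abs_add_int_pow {k : ℕ} (hk : 2 ≤ k) (t : ℝ) :
    Summable fun l : ℤ => (|t + l| ^ k)⁻¹ := by
  have h := (Real.summable_one_div_int_add_rpow t k).2 (by exact_mod_cast hk)
  refine h.congr fun l => ?_
  rw [Real.rpow_natCast, one_div, add_comm]

lemma summable_latticeSum {k : ℕ} (hk : 2 ≤ k) (t : ℝ) :
    Summable fun l : ℤ => ((t + l) ^ k)⁻¹ := by
  refine Summable.of_norm ((summable_inv_abs_add_int_pow hk t).congr fun l => ?_)
  rw [norm_inv, norm_pow, Real.norm_eq_abs]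

lemma add_int_ne_zero {t : ℝ} (ht : t ∈ Set.Ioo (0 : ℝ) 1) (l : ℤ) : t + l ≠ 0 := by
  intro h
  have h1 : (-1 : ℝ) < l := by linarith [ht.2]
  have h2 : (l : ℝ) < 0 := by linarith [ht.1]
  have h1' : -1 < l := by exact_mod_cast h1
  have h2' : l < 0 := by exact_mod_cast h2
  omega

lemma hasDerivAt_latticeSum {k : ℕ} (hk : 2 ≤ k) {t : ℝ} (ht : t ∈ Set.Ioo (0 : ℝ) 1) :
    HasDerivAt (latticeSum k) (-k * latticeSum (k + 1) t) t := by
  obtain ⟨a, ha0, hat⟩ := exists_between ht.1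
  obtain ⟨b, htb, hb1⟩ := exists_between ht.2
  have hu : Summable fun l : ℤ => (k : ℝ) * ((|a + l| ^ (k + 1))⁻¹ + (|b + l| ^ (k + 1))⁻¹) :=
    ((summable_inv_abs_add_int_pow (by omega) a).add
      (summable_inv_abs_add_int_pow (by omega) b)).mul_left _
  have hsub : ∀ y ∈ Set.Ioo a b, y ∈ Set.Ioo (0 : ℝ) 1 := fun y hy =>
    ⟨ha0.trans hy.1, hy.2.trans hb1⟩
  have key := hasDerivAt_tsum_of_isPreconnected (y₀ := t) (y := t)
    (g := fun (l : ℤ) (y : ℝ) => ((y + l) ^ k)⁻¹)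
    (g' := fun (l : ℤ) (y : ℝ) => -(k : ℝ) * ((y + l) ^ (k + 1))⁻¹) hu isOpen_Ioo
    isPreconnected_Ioo (fun l y hy => ?_) (fun l y hy => ?_) ⟨hat, htb⟩
    (summable_latticeSum hk t) ⟨hat, htb⟩
  · rw [tsum_mul_left] at key
    exact key
  · have hne := add_int_ne_zero (hsub y hy) l
    have h1 := (((hasDerivAt_id y).add_const (l : ℝ)).pow k).inv (pow_ne_zero k hne)
    simp only [id] at h1
    refine h1.congr_deriv ?_
    obtain ⟨j, rfl⟩ : ∃ j, k = j + 1 := ⟨k - 1, by omega⟩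
    simp only [Pi.pow_apply, add_tsub_cancel_right]
    field_simp
    ring
  · rw [norm_mul, norm_neg, norm_inv, norm_pow, Real.norm_eq_abs, Real.norm_eq_abs,
      abs_of_nonneg (Nat.cast_nonneg k : (0 : ℝ) ≤ k)]
    refine mul_le_mul_of_nonneg_left ?_ (Nat.cast_nonneg k)
    -- on `(a, b)` the term with index `l` is largest at `a` if `0 ≤ l`, and at `b` if `l < 0`
    rcases le_or_gt 0 l with hl | hl
    · have hl' : (0 : ℝ) ≤ l := by exact_mod_cast hl
      have h2 : (|y + l| ^ (k + 1))⁻¹ ≤ (|a + l| ^ (k + 1))⁻¹ := by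
        have : 0 < |a + l| := abs_pos.2 (by positivity)
        have h3 : |a + l| ≤ |y + l| := by
          rw [abs_of_nonneg (by positivity), abs_of_nonneg (by linarith [hy.1])]
          linarith [hy.1]
        gcongr
      exact h2.trans (le_add_of_nonneg_right (by positivity))
    · have hl' : (l : ℝ) ≤ -1 := by exact_mod_cast (by omega : l ≤ -1)
      have h2 : (|y + l| ^ (k + 1))⁻¹ ≤ (|b + l| ^ (k + 1))⁻¹ := by
        have : 0 < |b + l| := abs_pos.2 (by linarith : b + l < 0).ne
        have h3 : |b + l| ≤ |y + l| := by
          rw [abs_of_nonpos (by linarith), abs_of_nonpos (by linarith [hy.2])]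
          linarith [hy.2]
        gcongr
      exact h2.trans (le_add_of_nonneg_left (by positivity))

lemma sin_pi_mul_pos {t : ℝ} (ht : t ∈ Set.Ioo (0 : ℝ) 1) : 0 < Real.sin (Real.pi * t) :=
  Real.sin_pos_of_pos_of_lt_pi (mul_pos Real.pi_pos ht.1)
    (by nlinarith [Real.pi_pos, ht.2])

lemma norm_exp_two_pi_sub_one_sq (t : ℝ) :
    ‖Complex.exp (2 * Real.pi * t * Complex.I) - 1‖ ^ 2 = 4 * Real.sin (Real.pi * t) ^ 2 := by
  have h : (2 * Real.pi * t * Complex.I : ℂ) = ((2 * Real.pi * t : ℝ) : ℂ) * Complex.I := by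
    push_cast; ring
  rw [h, Complex.exp_mul_I, ← Complex.ofReal_cos, ← Complex.ofReal_sin, Complex.sq_norm,
    Complex.normSq_apply]
  simp only [Complex.sub_re, Complex.add_re, Complex.ofReal_re, Complex.mul_re, Complex.I_re,
    Complex.ofReal_im, Complex.I_im, Complex.one_re, Complex.sub_im, Complex.add_im,
    Complex.mul_im, Complex.one_im]
  rw [show 2 * Real.pi * t = 2 * (Real.pi * t) by ring, Real.cos_two_mul, Real.sin_two_mul]
  have := Real.sin_sq_add_cos_sq (Real.pi * t)
  have h2 : Real.cos (Real.pi * t) ^ 2 = 1 - Real.sin (Real.pi * t) ^ 2 := by linarith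
  ring_nf
  rw [show Real.cos (Real.pi * t) ^ 4 = (Real.cos (Real.pi * t) ^ 2) ^ 2 by ring, h2]
  ring

/-- `∑ (t + l)⁻² = π² / sin² (π t)`: Parseval's identity on `(0, 1]` for the function
`x ↦ exp (2 π i t x)`. -/
lemma latticeSum_two {t : ℝ} (ht : t ∈ Set.Ioo (0 : ℝ) 1) :
    latticeSum 2 t = Real.pi ^ 2 / Real.sin (Real.pi * t) ^ 2 := by
  have hcont : Continuous fun x : ℝ => Complex.exp (2 * Real.pi * t * x * Complex.I) := by fun_prop
  have hnorm : ∀ x : ℝ, ‖Complex.exp (2 * Real.pi * t * x * Complex.I)‖ = 1 := fun x => by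
    rw [show (2 * Real.pi * t * x * Complex.I : ℂ) = ((2 * Real.pi * t * x : ℝ) : ℂ) * Complex.I by
      push_cast; ring, Complex.norm_exp_ofReal_mul_I]
  have hmem : MemLp (fun x : ℝ => Complex.exp (2 * Real.pi * t * x * Complex.I)) 2
      (volume.restrict (Set.Ioc 0 1)) :=
    MemLp.of_bound hcont.aestronglyMeasurable 1 (ae_of_all _ fun x => (hnorm x).le)
  have h := hasSum_sq_fourierCoeffOn zero_lt_one hmem
  have hs := sin_pi_mul_pos ht
  have hco : ∀ l : ℤ, ‖fourierCoeffOn zero_lt_one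
      (fun x : ℝ => Complex.exp (2 * Real.pi * t * x * Complex.I)) l‖ ^ 2 =
      Real.sin (Real.pi * t) ^ 2 / Real.pi ^ 2 * ((t + ((-l : ℤ) : ℝ)) ^ 2)⁻¹ := fun l => by
    have hne : t - l ≠ 0 := by
      have := add_int_ne_zero ht (-l)
      push_cast at this
      simpa [sub_eq_add_neg] using this
    have hc : (2 * Real.pi * (t - l) * Complex.I : ℂ) ≠ 0 := by
      have : ((t - l : ℝ) : ℂ) ≠ 0 := by exact_mod_cast hne
      push_cast at this
      simp [this, Real.pi_ne_zero]
    have e1 : fourierCoeffOn zero_lt_one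
        (fun x : ℝ => Complex.exp (2 * Real.pi * t * x * Complex.I)) l =
        (Complex.exp (2 * Real.pi * t * Complex.I) - 1) / (2 * Real.pi * (t - l) * Complex.I) := by
      rw [fourierCoeffOn_eq_integral]
      have e2 : ∀ x : ℝ, (fourier (-l) (x : AddCircle ((1 : ℝ) - 0)) : ℂ) •
          Complex.exp (2 * Real.pi * t * x * Complex.I) =
          Complex.exp ((2 * Real.pi * (t - l) * Complex.I) * x) := fun x => by
        rw [fourier_coe_apply, smul_eq_mul, ← Complex.exp_add]
        congr 1
        push_cast
        simp
        ring
      simp only [e2]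
      rw [integral_exp_mul_complex hc]
      have : Complex.exp (2 * Real.pi * (t - l) * Complex.I * ((1 : ℝ) : ℂ)) =
          Complex.exp (2 * Real.pi * t * Complex.I) := by
        rw [Complex.exp_eq_exp_iff_exists_int]
        exact ⟨-l, by push_cast; ring⟩
      rw [this]
      simp
    rw [e1, norm_div, div_pow, norm_exp_two_pi_sub_one_sq]
    have e3 : ‖(2 * Real.pi * (t - l) * Complex.I : ℂ)‖ ^ 2 = 4 * Real.pi ^ 2 * (t - l) ^ 2 := by
      rw [show (2 * Real.pi * (t - l) * Complex.I : ℂ) =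
        ((2 * Real.pi * (t - l) : ℝ) : ℂ) * Complex.I by push_cast; ring, norm_mul,
        Complex.norm_I, Complex.norm_real, mul_one, Real.norm_eq_abs, sq_abs]
      ring
    rw [e3]
    push_cast
    rw [← sub_eq_add_neg]
    have := Real.pi_pos
    field_simp
  simp only [hco, hnorm] at h
  have h2 := h.tsum_eq
  rw [tsum_mul_left] at h2
  have h3 : ∑' l : ℤ, ((t + ((-l : ℤ) : ℝ)) ^ 2)⁻¹ = latticeSum 2 t :=
    (Equiv.neg ℤ).tsum_eq fun l : ℤ => ((t + (l : ℝ)) ^ 2)⁻¹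
  rw [h3] at h2
  have := Real.pi_pos
  simp at h2
  field_simp at h2 ⊢
  linarith

open Polynomial in
/-- The differential operator on polynomials that corresponds to `π⁻² d²/dt²` under the
substitution `z = cot² (π t)`. -/
noncomputable def cotOp (H : ℝ[X]) : ℝ[X] :=
  C 4 * (X * (1 + X) ^ 2) * derivative (derivative H) + (1 + X) * (C 2 + C 6 * X) * derivative H

open Polynomial in
/-- The polynomials `Hₙ` with `(2n + 1)! ∑ (t + l)⁻²ⁿ⁻² = π²ⁿ⁺² Hₙ(cot² (π t))`. -/
noncomputable def cotPoly : ℕ → ℝ[X]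
  | 0 => 1 + X
  | n + 1 => cotOp (cotPoly n)

lemma hasDerivAt_cos_div_sin {t : ℝ} (ht : t ∈ Set.Ioo (0 : ℝ) 1) :
    HasDerivAt (fun t => Real.cos (Real.pi * t) / Real.sin (Real.pi * t))
      (-Real.pi * (1 + (Real.cos (Real.pi * t) / Real.sin (Real.pi * t)) ^ 2)) t := by
  have hs := (sin_pi_mul_pos ht).ne'
  have h0 : HasDerivAt (fun t : ℝ => Real.pi * t) Real.pi t := by
    simpa using (hasDerivAt_id t).const_mul Real.pi
  refine (h0.cos.div h0.sin hs).congr_deriv ?_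
  field_simp
  ring

open Polynomial in
lemma hasDerivAt_eval_cot_sq (P : ℝ[X]) {t : ℝ} (ht : t ∈ Set.Ioo (0 : ℝ) 1) :
    HasDerivAt (fun t => P.eval ((Real.cos (Real.pi * t) / Real.sin (Real.pi * t)) ^ 2))
      (-2 * Real.pi * ((Real.cos (Real.pi * t) / Real.sin (Real.pi * t)) *
        (1 + (Real.cos (Real.pi * t) / Real.sin (Real.pi * t)) ^ 2)) *
        (derivative P).eval ((Real.cos (Real.pi * t) / Real.sin (Real.pi * t)) ^ 2)) t := by
  refine ((P.hasDerivAt _).comp t ((hasDerivAt_cos_div_sin ht).pow 2)).congr_deriv ?_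
  simp
  ring

/-- Two differentiations of a lattice sum raise its exponent by two, and act as `cotOp` on the
polynomial in `cot² (π t)`. -/
lemma latticeSum_eq_cotPoly (n : ℕ) {t : ℝ} (ht : t ∈ Set.Ioo (0 : ℝ) 1) :
    ((2 * n + 1).factorial : ℝ) * latticeSum (2 * n + 2) t = Real.pi ^ (2 * n + 2) *
      (cotPoly n).eval ((Real.cos (Real.pi * t) / Real.sin (Real.pi * t)) ^ 2) := by
  induction n generalizing t with
  | zero =>
    have hs := (sin_pi_mul_pos ht).ne'
    simp [latticeSum_two ht, cotPoly]
    field_simp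
    linarith [Real.sin_sq_add_cos_sq (Real.pi * t)]
  | succ n ih =>
    -- first derivatives of both sides agree on the open interval
    have h1 : ∀ u ∈ Set.Ioo (0 : ℝ) 1, ((2 * n + 1).factorial : ℝ) *
        (-(2 * n + 2 : ℕ) * latticeSum (2 * n + 3) u) = Real.pi ^ (2 * n + 2) *
        (-2 * Real.pi * ((Real.cos (Real.pi * u) / Real.sin (Real.pi * u)) *
        (1 + (Real.cos (Real.pi * u) / Real.sin (Real.pi * u)) ^ 2)) *
        (Polynomial.derivative (cotPoly n)).eval
          ((Real.cos (Real.pi * u) / Real.sin (Real.pi * u)) ^ 2)) := fun u hu => by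
      refine ((hasDerivAt_latticeSum (by omega) hu).const_mul _).unique ?_
      refine ((hasDerivAt_eval_cot_sq _ hu).const_mul _).congr_of_eventuallyEq ?_
      filter_upwards [isOpen_Ioo.mem_nhds hu] with v hv using ih hv
    have hev := Filter.eventually_of_mem (isOpen_Ioo.mem_nhds ht) h1
    have h2 := (((hasDerivAt_latticeSum (by omega : 2 ≤ 2 * n + 3) ht).const_mul
      (-((2 * n + 2 : ℕ) : ℝ))).const_mul ((2 * n + 1).factorial : ℝ)).unique
      (((((hasDerivAt_cos_div_sin ht).mul (((hasDerivAt_cos_div_sin ht).pow 2).const_add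
        1)).const_mul (-2 * Real.pi)).mul (hasDerivAt_eval_cot_sq
        (Polynomial.derivative (cotPoly n)) ht)).const_mul
        (Real.pi ^ (2 * n + 2)) |>.congr_of_eventuallyEq hev)
    have h3 : ((2 * (n + 1) + 1).factorial : ℝ) =
        (2 * n + 3 : ℕ) * ((2 * n + 2 : ℕ) * (2 * n + 1).factorial) := by
      rw [show 2 * (n + 1) + 1 = (2 * n + 1 + 1) + 1 by ring, Nat.factorial_succ,
        Nat.factorial_succ]
      push_cast
      ring
    rw [h3, show 2 * (n + 1) + 2 = 2 * n + 4 by ring]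
    refine Eq.trans (by ring) (h2.trans ?_)
    simp only [cotPoly, cotOp]
    simp
    ring

open Polynomial in
lemma coeff_cotOp_zero (H : ℝ[X]) : (cotOp H).coeff 0 = 2 * H.coeff 1 := by
  have h : (derivative H).eval 0 = H.coeff 1 := by
    rw [← coeff_zero_eq_eval_zero, coeff_derivative]
    simp
  rw [coeff_zero_eq_eval_zero, cotOp]
  simp [h]

open Polynomial in
lemma coeff_cotOp_succ (H : ℝ[X]) (i : ℕ) : (cotOp H).coeff (i + 1) =
    2 * i * (2 * i + 1) * H.coeff i + 8 * (i + 1) ^ 2 * H.coeff (i + 1) +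
      2 * (i + 2) * (2 * i + 3) * H.coeff (i + 2) := by
  have e : cotOp H = C 4 * (X * derivative (derivative H)) +
      C 8 * (X * (X * derivative (derivative H))) +
      C 4 * (X * (X * (X * derivative (derivative H)))) + C 2 * derivative H +
      C 8 * (X * derivative H) + C 6 * (X * (X * derivative H)) := by
    rw [show (C 8 : ℝ[X]) = C 4 + C 4 by rw [← C_add]; norm_num,
      show (C 6 : ℝ[X]) = C 4 + C 2 by rw [← C_add]; norm_num,
      show (C 4 : ℝ[X]) = C 2 + C 2 by rw [← C_add]; norm_num, cotOp,
      show (C 6 : ℝ[X]) = C 2 + C 2 + C 2 by rw [← C_add, ← C_add]; norm_num,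
      show (C 4 : ℝ[X]) = C 2 + C 2 by rw [← C_add]; norm_num]
    ring
  rw [e]
  rcases i with _ | _ | i
  · simp [coeff_X_mul, coeff_derivative]; ring
  · simp [coeff_X_mul, coeff_derivative]; ring
  · simp [coeff_X_mul, coeff_derivative]; ring

/-- The ratio `b i / a i` is nondecreasing in `i`, written without divisions. -/
def RatioMono (a b : ℕ → ℝ) : Prop := ∀ i j, i ≤ j → a j * b i ≤ a i * b j

/-- The tridiagonal coefficient matrix of `cotOp` is nonnegative with nonnegative `2 × 2` minors,
so by the Cauchy–Binet formula `cotOp` preserves monotone ratios of coefficients. -/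
lemma RatioMono.cotOp {P Q : Polynomial ℝ} (h : RatioMono P.coeff Q.coeff) :
    RatioMono (cotOp P).coeff (cotOp Q).coeff := by
  intro i j hij
  have D : ∀ p q, p ≤ q → 0 ≤ P.coeff p * Q.coeff q - P.coeff q * Q.coeff p := fun p q hpq =>
    sub_nonneg.2 (h p q hpq)
  rcases i with _ | i
  · rcases j with _ | j
    · exact le_rfl
    · rw [coeff_cotOp_zero, coeff_cotOp_zero, coeff_cotOp_succ, coeff_cotOp_succ, ← sub_nonneg]
      have h0 : 0 ≤ (j : ℝ) *
          (P.coeff 1 * Q.coeff j - P.coeff j * Q.coeff 1) := by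
        rcases j with _ | j
        · simp
        · exact mul_nonneg (by positivity) (D _ _ (by omega))
      have h1 := D 1 (j + 1) (by omega)
      have h2 := D 1 (j + 2) (by omega)
      have : 0 ≤ 4 * (2 * j + 1) * ((j : ℝ) *
          (P.coeff 1 * Q.coeff j - P.coeff j * Q.coeff 1)) +
          16 * ((j : ℝ) + 1) ^ 2 *
            (P.coeff 1 * Q.coeff (j + 1) - P.coeff (j + 1) * Q.coeff 1) +
          4 * ((j : ℝ) + 2) * (2 * j + 3) *
            (P.coeff 1 * Q.coeff (j + 2) - P.coeff (j + 2) * Q.coeff 1) := by positivity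
      linarith
  · rcases j with _ | j
    · omega
    rcases hij.eq_or_lt with hij | hij
    · rw [hij]
    rw [coeff_cotOp_succ, coeff_cotOp_succ, coeff_cotOp_succ, coeff_cotOp_succ, ← sub_nonneg]
    have d00 := D i j (by omega)
    have d01 := D i (j + 1) (by omega)
    have d02 := D i (j + 2) (by omega)
    have d10 := D (i + 1) j (by omega)
    have d11 := D (i + 1) (j + 1) (by omega)
    have d12 := D (i + 1) (j + 2) (by omega)
    have d21 := D (i + 2) (j + 1) (by omega)
    have d22 := D (i + 2) (j + 2) (by omega)
    -- the minor with the two middle columns is the only one that can be reversed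
    have d20 : 0 ≤ 8 * ((i : ℝ) + 1) ^ 2 * (8 * ((j : ℝ) + 1) ^ 2) *
        (P.coeff (i + 1) * Q.coeff (j + 1) - P.coeff (j + 1) * Q.coeff (i + 1)) +
        2 * ((i : ℝ) + 2) * (2 * i + 3) * (2 * j * (2 * j + 1)) *
        (P.coeff (i + 2) * Q.coeff j - P.coeff j * Q.coeff (i + 2)) := by
      rcases Nat.lt_or_ge j (i + 2) with hj | hj
      · obtain rfl : j = i + 1 := by omega
        have : 0 ≤ (8 * ((i : ℝ) + 1) ^ 2 * (8 * ((i : ℝ) + 1 + 1) ^ 2) -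
          2 * ((i : ℝ) + 2) * (2 * i + 3) * (2 * (i + 1) * (2 * (i + 1) + 1))) *
          (P.coeff (i + 1) * Q.coeff (i + 2) - P.coeff (i + 2) * Q.coeff (i + 1)) := by
          refine mul_nonneg ?_ d11
          have : 8 * ((i : ℝ) + 1) ^ 2 * (8 * ((i : ℝ) + 1 + 1) ^ 2) -
              2 * ((i : ℝ) + 2) * (2 * i + 3) * (2 * (i + 1) * (2 * (i + 1) + 1)) =
              4 * (i + 1) * (i + 2) * (12 * (i : ℝ) ^ 2 + 36 * i + 23) := by ring
          rw [this]; positivity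
        push_cast
        linarith
      · have := D (i + 2) j hj
        positivity
    have : 0 ≤ 2 * (i : ℝ) * (2 * i + 1) * (2 * (j : ℝ) * (2 * j + 1)) *
          (P.coeff i * Q.coeff j - P.coeff j * Q.coeff i) +
        2 * (i : ℝ) * (2 * i + 1) * (8 * ((j : ℝ) + 1) ^ 2) *
          (P.coeff i * Q.coeff (j + 1) - P.coeff (j + 1) * Q.coeff i) +
        2 * (i : ℝ) * (2 * i + 1) * (2 * ((j : ℝ) + 2) * (2 * j + 3)) *
          (P.coeff i * Q.coeff (j + 2) - P.coeff (j + 2) * Q.coeff i) +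
        8 * ((i : ℝ) + 1) ^ 2 * (2 * (j : ℝ) * (2 * j + 1)) *
          (P.coeff (i + 1) * Q.coeff j - P.coeff j * Q.coeff (i + 1)) +
        8 * ((i : ℝ) + 1) ^ 2 * (2 * ((j : ℝ) + 2) * (2 * j + 3)) *
          (P.coeff (i + 1) * Q.coeff (j + 2) - P.coeff (j + 2) * Q.coeff (i + 1)) +
        2 * ((i : ℝ) + 2) * (2 * i + 3) * (8 * ((j : ℝ) + 1) ^ 2) *
          (P.coeff (i + 2) * Q.coeff (j + 1) - P.coeff (j + 1) * Q.coeff (i + 2)) +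
        2 * ((i : ℝ) + 2) * (2 * i + 3) * (2 * ((j : ℝ) + 2) * (2 * j + 3)) *
          (P.coeff (i + 2) * Q.coeff (j + 2) - P.coeff (j + 2) * Q.coeff (i + 2)) := by
      positivity
    linarith

lemma ratioMono_cotPoly_succ (n : ℕ) :
    RatioMono (cotPoly n).coeff (cotPoly (n + 1)).coeff := by
  induction n with
  | zero =>
    intro i j hij
    rcases i with _ | _ | i <;> rcases j with _ | _ | j <;>
      simp only [cotPoly, coeff_cotOp_zero, coeff_cotOp_succ] <;>
      norm_num [Polynomial.coeff_one, Polynomial.coeff_X] <;> first | omega | positivity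
  | succ n ih => exact ih.cotOp

lemma cotPoly_ratio_le (n : ℕ) {z : ℝ} (hz : 0 ≤ z) :
    (cotPoly n).eval z * (cotPoly (n + 1)).eval 0 ≤
      (cotPoly n).eval 0 * (cotPoly (n + 1)).eval z := by
  rw [← Polynomial.coeff_zero_eq_eval_zero, ← Polynomial.coeff_zero_eq_eval_zero]
  set N := max (cotPoly n).natDegree (cotPoly (n + 1)).natDegree + 1
  rw [Polynomial.eval_eq_sum_range' (n := N) (by omega),
    Polynomial.eval_eq_sum_range' (n := N) (by omega), Finset.sum_mul, Finset.mul_sum]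
  refine Finset.sum_le_sum fun j _ => ?_
  have := mul_le_mul_of_nonneg_right (ratioMono_cotPoly_succ n 0 j (Nat.zero_le _))
    (pow_nonneg hz j)
  linarith

lemma latticeSum_pos {n : ℕ} {t : ℝ} (ht : t ∈ Set.Ioo (0 : ℝ) 1) :
    0 < latticeSum (2 * n + 2) t := by
  refine (summable_latticeSum (by omega) t).tsum_pos (fun l => ?_) 0 ?_
  · rw [show 2 * n + 2 = 2 * (n + 1) by ring, pow_mul]
    positivity
  · have := ht.1
    simp only [Int.cast_zero, add_zero]
    positivity

/-- The quotient of two even lattice sums is largest at the midpoint `1 / 2`, where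
`cot (π t) = 0`. -/
lemma latticeSum_mul_le_succ (n : ℕ) {t : ℝ} (ht : t ∈ Set.Ioo (0 : ℝ) 1) :
    latticeSum (2 * n + 2) t * latticeSum (2 * n + 4) (1 / 2) ≤
      latticeSum (2 * n + 2) (1 / 2) * latticeSum (2 * n + 4) t := by
  have hh : (1 / 2 : ℝ) ∈ Set.Ioo (0 : ℝ) 1 := by norm_num
  have hc : Real.cos (Real.pi * (1 / 2)) = 0 := by
    rw [show Real.pi * (1 / 2) = Real.pi / 2 by ring, Real.cos_pi_div_two]
  have h1 := latticeSum_eq_cotPoly n ht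
  have h2 := latticeSum_eq_cotPoly (n + 1) ht
  have h3 := latticeSum_eq_cotPoly n hh
  have h4 := latticeSum_eq_cotPoly (n + 1) hh
  rw [hc, zero_div, zero_pow two_ne_zero] at h3 h4
  have h5 := cotPoly_ratio_le n
    (sq_nonneg (Real.cos (Real.pi * t) / Real.sin (Real.pi * t)))
  have hf : (0 : ℝ) < (2 * n + 1).factorial * (2 * (n + 1) + 1).factorial := by positivity
  refine le_of_mul_le_mul_left ?_ hf
  have h6 := mul_le_mul_of_nonneg_left h5
    (by positivity : 0 ≤ Real.pi ^ (2 * n + 2) * Real.pi ^ (2 * (n + 1) + 2))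
  calc _ = (((2 * n + 1).factorial : ℝ) * latticeSum (2 * n + 2) t) *
        (((2 * (n + 1) + 1).factorial : ℝ) * latticeSum (2 * (n + 1) + 2) (1 / 2)) := by ring_nf
    _ ≤ (((2 * n + 1).factorial : ℝ) * latticeSum (2 * n + 2) (1 / 2)) *
        (((2 * (n + 1) + 1).factorial : ℝ) * latticeSum (2 * (n + 1) + 2) t) := by
      rw [h1, h2, h3, h4]
      linarith
    _ = _ := by ring_nf

lemma latticeSum_mul_le (n k : ℕ) {t : ℝ} (ht : t ∈ Set.Ioo (0 : ℝ) 1) :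
    latticeSum (2 * n + 2) t * latticeSum (2 * (n + k) + 2) (1 / 2) ≤
      latticeSum (2 * n + 2) (1 / 2) * latticeSum (2 * (n + k) + 2) t := by
  have hh : (1 / 2 : ℝ) ∈ Set.Ioo (0 : ℝ) 1 := by norm_num
  induction k with
  | zero => exact (mul_comm _ _).le
  | succ k ih =>
    have h1 := latticeSum_mul_le_succ (n + k) ht
    have p1 := latticeSum_pos (n := n + k) ht
    have p2 := latticeSum_pos (n := n + k) hh
    have p3 := latticeSum_pos (n := n) hh
    have p4 : 0 < latticeSum (2 * (n + k) + 4) (1 / 2) := latticeSum_pos (n := n + k + 1) hh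
    rw [show 2 * (n + (k + 1)) + 2 = 2 * (n + k) + 4 by ring]
    refine le_of_mul_le_mul_right ?_ p2
    calc _ = (latticeSum (2 * n + 2) t * latticeSum (2 * (n + k) + 2) (1 / 2)) *
          latticeSum (2 * (n + k) + 4) (1 / 2) := by ring
      _ ≤ (latticeSum (2 * n + 2) (1 / 2) * latticeSum (2 * (n + k) + 2) t) *
          latticeSum (2 * (n + k) + 4) (1 / 2) := mul_le_mul_of_nonneg_right ih p4.le
      _ = latticeSum (2 * n + 2) (1 / 2) * (latticeSum (2 * (n + k) + 2) t *
          latticeSum (2 * (n + k) + 4) (1 / 2)) := by ring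
      _ ≤ latticeSum (2 * n + 2) (1 / 2) * (latticeSum (2 * (n + k) + 2) (1 / 2) *
          latticeSum (2 * (n + k) + 4) t) := mul_le_mul_of_nonneg_left h1 p3.le
      _ = _ := by ring

/-! ### Favard constants -/

/-- At the midpoint the lattice sum over `ℤ` is twice the sum over `ℕ`, by the symmetry
`l ↦ -1 - l`. -/
lemma latticeSum_half (n : ℕ) : latticeSum (2 * n + 2) (1 / 2) =
    2 ^ (2 * n + 3) * ∑' l : ℕ, ((1 + 2 * (l : ℝ)) ^ (2 * n + 2))⁻¹ := by
  have hs := summable_latticeSum (k := 2 * n + 2) (by omega) (1 / 2)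
  have h1 : ∀ l : ℕ, ((1 / 2 + ((l : ℤ) : ℝ)) ^ (2 * n + 2))⁻¹ =
      2 ^ (2 * n + 2) * ((1 + 2 * (l : ℝ)) ^ (2 * n + 2))⁻¹ := fun l => by
    rw [show (1 / 2 + ((l : ℤ) : ℝ)) = (1 + 2 * l) / 2 by push_cast; ring_nf, div_pow, inv_div,
      div_eq_mul_inv]
  have h2 : ∀ l : ℕ, ((1 / 2 + ((-(l + 1 : ℤ) : ℤ) : ℝ)) ^ (2 * n + 2))⁻¹ =
      2 ^ (2 * n + 2) * ((1 + 2 * (l : ℝ)) ^ (2 * n + 2))⁻¹ := fun l => by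
    rw [show (1 / 2 + ((-(l + 1 : ℤ) : ℤ) : ℝ)) = -((1 + 2 * l) / 2) by push_cast; ring_nf,
      Even.neg_pow (show Even (2 * n + 2) from ⟨n + 1, by omega⟩), div_pow, inv_div, div_eq_mul_inv]
  have h3 : Summable fun l : ℕ => ((1 / 2 + ((l : ℤ) : ℝ)) ^ (2 * n + 2))⁻¹ :=
    hs.comp_injective Nat.cast_injective
  have h4 : Summable fun l : ℕ => ((1 / 2 + ((-(l + 1 : ℤ) : ℤ) : ℝ)) ^ (2 * n + 2))⁻¹ :=
    hs.comp_injective (i := fun l : ℕ => -((l : ℤ) + 1)) fun a b hab => by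
      have : -((a : ℤ) + 1) = -((b : ℤ) + 1) := hab
      omega
  have h5 := tsum_of_nat_of_neg_add_one
    (f := fun l : ℤ => (((1 : ℝ) / 2 + (l : ℝ)) ^ (2 * n + 2))⁻¹) h3 h4
  rw [latticeSum, h5]
  simp only [h1, h2, tsum_mul_left]
  ring

/-- For odd indices the series that defines the Favard constant has positive terms and converges,
so that `limUnder` is its sum. -/
lemma favard_odd (n : ℕ) :
    latticeSum (2 * n + 2) (1 / 2) = 2 ^ (2 * n + 1) * Real.pi * favard (2 * n + 1) := by
  have hs : Summable fun l : ℕ => ((1 + 2 * (l : ℝ)) ^ (2 * n + 2))⁻¹ := by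
    have := (summable_latticeSum (k := 2 * n + 2) (by omega) (1 / 2)).comp_injective
      (Nat.cast_injective (R := ℤ))
    refine (this.mul_left ((2 : ℝ) ^ (2 * n + 2))⁻¹).congr fun l => ?_
    rw [Function.comp, show (1 / 2 + ((l : ℤ) : ℝ)) = (1 + 2 * l) / 2 by push_cast; ring_nf,
      div_pow, inv_div]
    field_simp
  have h : Tendsto (fun N : ℕ => ∑ l ∈ Finset.range N,
      (-1 : ℝ) ^ (l * (2 * n + 1 + 1)) / (1 + 2 * (l : ℝ)) ^ (2 * n + 1 + 1)) atTop
      (𝓝 (∑' l : ℕ, ((1 + 2 * (l : ℝ)) ^ (2 * n + 2))⁻¹)) := by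
    refine hs.hasSum.tendsto_sum_nat.congr fun N => Finset.sum_congr rfl fun l _ => ?_
    rw [Even.neg_one_pow (Even.mul_left (show Even (2 * n + 1 + 1) from ⟨n + 1, by omega⟩) _),
      one_div]
  rw [latticeSum_half, favard, h.limUnder_eq]
  have := Real.pi_pos
  field_simp
  ring

/-! ### Plancherel's theorem for integrable functions -/

section Plancherel

open scoped FourierTransform

/-- For `f` in `L¹ ∩ L²` the Fourier transform in `L²` is given by the Fourier integral, since
both define the same tempered distribution. -/
lemma coeFn_fourier_toLp_ae_eq {f : ℝ → ℂ} (h1 : Integrable f) (h2 : MemLp f 2) :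
    ((𝓕 (h2.toLp f) : Lp ℂ 2 (volume : Measure ℝ)) : ℝ → ℂ) =ᵐ[volume] 𝓕 f := by
  have hcont : Continuous (𝓕 f) := VectorFourier.fourierIntegral_continuous
    Real.continuous_fourierChar (by exact continuous_inner) h1
  refine ae_eq_of_integral_contDiff_smul_eq ((Lp.memLp _).locallyIntegrable one_le_two)
    hcont.locallyIntegrable fun g hg hc => ?_
  have hc' : HasCompactSupport (fun x => (g x : ℂ)) := hc.comp_left (g := Complex.ofReal) rfl
  have hg' : ContDiff ℝ (⊤ : ℕ∞) (fun x => (g x : ℂ)) := Complex.ofRealCLM.contDiff.comp hg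
  let G : SchwartzMap ℝ ℂ := hc'.toSchwartzMap hg'
  have hG : ∀ x, G x = (g x : ℂ) := fun x => rfl
  have key := congrArg (fun T => T G)
    (MeasureTheory.Lp.fourier_toTemperedDistribution_eq (h2.toLp f))
  simp only [TemperedDistribution.fourier_apply, Lp.toTemperedDistribution_apply, smul_eq_mul,
    hG] at key
  have h3 := VectorFourier.integral_fourierIntegral_smul_eq_flip (μ := volume) (ν := volume)
    (L := innerₗ ℝ) (f := f) (g := G) Real.continuous_fourierChar
    (by exact continuous_inner) h1 G.integrable
  rw [flip_innerₗ] at h3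
  simp only [Complex.real_smul]
  rw [← key]
  refine Eq.trans ?_ (h3.symm.trans ?_)
  · refine integral_congr_ae ?_
    filter_upwards [h2.coeFn_toLp] with x hx
    rw [hx, mul_comm]
    rfl
  · refine integral_congr_ae (ae_of_all _ fun x => ?_)
    exact mul_comm _ _

lemma eLpNorm_fourier_eq {f : ℝ → ℂ} (h1 : Integrable f) (h2 : MemLp f 2) :
    eLpNorm (𝓕 f) 2 volume = eLpNorm f 2 volume := by
  rw [← eLpNorm_congr_ae (coeFn_fourier_toLp_ae_eq h1 h2), ← eLpNorm_congr_ae h2.coeFn_toLp,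
    ← Lp.enorm_def, ← Lp.enorm_def, ← ofReal_norm, ← ofReal_norm, Lp.norm_fourier_eq]

end Plancherel

/-! ### Cardinal B-splines -/

lemma measurable_truncPow (m : ℕ) : Measurable (truncPow m) :=
  Measurable.ite measurableSet_Ici (measurable_id.pow_const m) measurable_const

lemma continuous_truncPow_succ (m : ℕ) : Continuous (truncPow (m + 1)) :=
  Continuous.if_le (by fun_prop) continuous_const continuous_const continuous_id fun x hx => by
    rw [← hx]; simp

lemma measurable_cardinalBSpline (m : ℕ) : Measurable (cardinalBSpline m) :=
  (Finset.measurable_sum _ fun _ _ => ((measurable_truncPow m).comp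
    (measurable_id.sub_const _)).const_mul _).const_mul _

lemma continuous_cardinalBSpline_succ (m : ℕ) : Continuous (cardinalBSpline (m + 1)) :=
  continuous_const.mul (continuous_finsetSum _ fun _ _ => continuous_const.mul
    ((continuous_truncPow_succ m).comp (continuous_id.sub continuous_const)))

lemma cardinalBSpline_of_neg (m : ℕ) {x : ℝ} (hx : x < 0) : cardinalBSpline m x = 0 := by
  rw [cardinalBSpline, Finset.sum_eq_zero, mul_zero]
  intro j _
  have : ¬ 0 ≤ x - j := by
    have : (0 : ℝ) ≤ j := Nat.cast_nonneg j
    linarith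
  rw [truncPow, if_neg this, mul_zero]

/-- To the right of its support the B-spline is an `(m + 1)`-st difference of a polynomial of
degree `m`. -/
lemma cardinalBSpline_of_ge (m : ℕ) {x : ℝ} (hx : (m : ℝ) + 1 ≤ x) : cardinalBSpline m x = 0 := by
  have h := congrFun (fwdDiff_iter_pow_eq_zero_of_lt (R := ℝ) (Nat.lt_succ_self m)) (-x)
  rw [fwdDiff_iter_eq_sum_shift] at h
  rw [cardinalBSpline]
  have e : ∀ j ∈ Finset.range (m + 2), (-1 : ℝ) ^ j * ((m + 1).choose j : ℝ) * truncPow m (x - j) =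
      -(((-1 : ℤ) ^ (m + 1 - j) * ((m + 1).choose j : ℤ)) • (-x + j • (1 : ℝ)) ^ m) := by
    intro j hj
    have hj' : j ≤ m + 1 := Nat.lt_succ_iff.1 (Finset.mem_range.1 hj)
    have hj'' : (j : ℝ) ≤ m + 1 := by exact_mod_cast hj'
    rw [truncPow, if_pos (by linarith), zsmul_eq_mul]
    have h1 : (-x + j • (1 : ℝ)) ^ m = (-1) ^ m * (x - j) ^ m := by
      rw [← mul_pow]; congr 1; simp; ring
    have h2 : (-1 : ℝ) ^ (m + 1 - j) * (-1) ^ j = -(-1) ^ m := by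
      rw [← pow_add, Nat.sub_add_cancel hj', pow_succ]; ring
    have h3 : (-1 : ℝ) ^ j * (-1) ^ j = 1 := by rw [← mul_pow]; simp
    have h4 : (-1 : ℝ) ^ m * (-1) ^ m = 1 := by rw [← mul_pow]; simp
    have h5 : (-1 : ℝ) ^ (m + 1 - j) = -(-1) ^ m * (-1) ^ j := by
      rw [← h2, mul_assoc, h3, mul_one]
    rw [h1]
    push_cast
    rw [h5]
    linear_combination (-(-1 : ℝ) ^ j * ((m + 1).choose j : ℝ) * (x - j) ^ m) * h4
  rw [Finset.sum_congr rfl e, Finset.sum_neg_distrib]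
  rw [show (m.succ + 1) = m + 2 from rfl] at h
  simp only [Nat.succ_eq_add_one] at h
  rw [h]
  simp

lemma hasDerivAt_truncPow_succ (m : ℕ) {x : ℝ} (hx : x ≠ 0) :
    HasDerivAt (truncPow (m + 1)) ((m + 1 : ℕ) * truncPow m x) x := by
  rcases lt_or_gt_of_ne hx with h | h
  · have : HasDerivAt (fun _ : ℝ => (0 : ℝ)) 0 x := hasDerivAt_const x 0
    rw [truncPow, if_neg (not_le.2 h), mul_zero]
    refine this.congr_of_eventuallyEq ?_
    filter_upwards [eventually_lt_nhds h] with y hy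
    rw [truncPow, if_neg (not_le.2 hy)]
  · rw [truncPow, if_pos h.le]
    refine (hasDerivAt_pow (m + 1) x).congr_of_eventuallyEq ?_
    filter_upwards [eventually_gt_nhds h] with y hy
    rw [truncPow, if_pos hy.le]

lemma sub_intCast_ne_zero {x : ℝ} (hx : x ∉ Set.range ((↑) : ℤ → ℝ)) (j : ℤ) : x - j ≠ 0 :=
  fun h => hx ⟨j, by linarith⟩

lemma hasDerivAt_cardinalBSpline_succ (m : ℕ) {x : ℝ} (hx : x ∉ Set.range ((↑) : ℤ → ℝ)) :
    HasDerivAt (cardinalBSpline (m + 1)) (cardinalBSpline m x - cardinalBSpline m (x - 1)) x := by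
  have h : HasDerivAt (cardinalBSpline (m + 1)) ((1 / ((m + 1).factorial : ℝ)) *
      ∑ j ∈ Finset.range (m + 3), (-1 : ℝ) ^ j * ((m + 2).choose j : ℝ) *
        ((m + 1 : ℕ) * truncPow m (x - j))) x := by
    refine (HasDerivAt.fun_sum fun j _ => ?_).const_mul _
    have h1 := (hasDerivAt_truncPow_succ m (sub_intCast_ne_zero hx j)).comp x
      ((hasDerivAt_id x).sub_const ((j : ℤ) : ℝ))
    rw [mul_one] at h1
    exact h1.const_mul _
  refine h.congr_deriv ?_
  rw [cardinalBSpline, cardinalBSpline, ← mul_sub]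
  have e1 : ∑ j ∈ Finset.range (m + 3), (-1 : ℝ) ^ j * ((m + 2).choose j : ℝ) *
      ((m + 1 : ℕ) * truncPow m (x - j)) = (m + 1 : ℕ) *
      ∑ j ∈ Finset.range (m + 3), (-1 : ℝ) ^ j * ((m + 2).choose j : ℝ) * truncPow m (x - j) := by
    rw [Finset.mul_sum]
    exact Finset.sum_congr rfl fun j _ => by ring
  have e2 : ∑ j ∈ Finset.range (m + 3), (-1 : ℝ) ^ j * ((m + 2).choose j : ℝ) *
      truncPow m (x - j) = ∑ j ∈ Finset.range (m + 2), (-1 : ℝ) ^ j * ((m + 1).choose j : ℝ) *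
      truncPow m (x - j) - ∑ j ∈ Finset.range (m + 2), (-1 : ℝ) ^ j * ((m + 1).choose j : ℝ) *
      truncPow m (x - 1 - j) := by
    have e3 : ∑ j ∈ Finset.range (m + 2), (-1 : ℝ) ^ j * ((m + 1).choose j : ℝ) *
        truncPow m (x - j) = ∑ j ∈ Finset.range (m + 3), (-1 : ℝ) ^ j * ((m + 1).choose j : ℝ) *
        truncPow m (x - j) := by
      rw [Finset.sum_range_succ _ (m + 2), Nat.choose_eq_zero_of_lt (by omega : m + 1 < m + 2)]
      simp
    rw [e3, Finset.sum_range_succ' _ (m + 2), Finset.sum_range_succ' _ (m + 2)]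
    rw [add_sub_right_comm, ← Finset.sum_sub_distrib]
    congr 1
    · refine Finset.sum_congr rfl fun j _ => ?_
      rw [Nat.choose_succ_succ (m + 1) j, show x - 1 - (j : ℝ) = x - ((j + 1 : ℕ) : ℝ) by
        push_cast; ring]
      push_cast
      ring
  rw [e1, e2, Nat.factorial_succ]
  have : (m.factorial : ℝ) ≠ 0 := by positivity
  have : ((m : ℝ) + 1) ≠ 0 := by positivity
  push_cast
  field_simp

lemma exists_bound_cardinalBSpline (m : ℕ) : ∃ B : ℝ, 0 ≤ B ∧ ∀ x, |cardinalBSpline m x| ≤ B := by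
  refine ⟨(1 / (m.factorial : ℝ)) *
    ∑ j ∈ Finset.range (m + 2), ((m + 1).choose j : ℝ) * ((m : ℝ) + 1) ^ m, by positivity,
    fun x => ?_⟩
  rcases lt_or_ge x 0 with hx | hx
  · rw [cardinalBSpline_of_neg m hx, abs_zero]; positivity
  rcases le_or_gt ((m : ℝ) + 1) x with hx' | hx'
  · rw [cardinalBSpline_of_ge m hx', abs_zero]; positivity
  rw [cardinalBSpline, abs_mul, abs_of_nonneg (by positivity : (0 : ℝ) ≤ 1 / (m.factorial : ℝ))]
  refine mul_le_mul_of_nonneg_left ((Finset.abs_sum_le_sum_abs _ _).trans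
    (Finset.sum_le_sum fun j _ => ?_)) (by positivity)
  rw [abs_mul, abs_mul, abs_pow, abs_neg, abs_one, one_pow, one_mul, Nat.abs_cast]
  refine mul_le_mul_of_nonneg_left ?_ (Nat.cast_nonneg _)
  rw [truncPow]
  split_ifs with h
  · rw [abs_of_nonneg (pow_nonneg h m)]
    have : (0 : ℝ) ≤ j := Nat.cast_nonneg j
    gcongr
    linarith
  · rw [abs_zero]; positivity

lemma memLp_cardinalBSpline (m : ℕ) (p : ENNReal) : MemLp (cardinalBSpline m) p := by
  obtain ⟨B, -, hB⟩ := exists_bound_cardinalBSpline m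
  have h : MemLp (cardinalBSpline m) p (volume.restrict (Set.Icc 0 ((m : ℝ) + 1))) :=
    MemLp.of_bound (measurable_cardinalBSpline m).aestronglyMeasurable B
      (ae_of_all _ fun x => by simpa using hB x)
  rw [← memLp_indicator_iff_restrict measurableSet_Icc] at h
  refine h.ae_eq (ae_of_all _ fun x => ?_)
  by_cases hx : x ∈ Set.Icc 0 ((m : ℝ) + 1)
  · rw [Set.indicator_of_mem hx]
  · rw [Set.indicator_of_notMem hx]
    rcases lt_or_ge x 0 with h0 | h0
    · rw [cardinalBSpline_of_neg m h0]
    · rw [cardinalBSpline_of_ge m]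
      by_contra h1
      exact hx ⟨h0, (not_le.1 h1).le⟩

lemma cardinalBSpline_zero (x : ℝ) :
    cardinalBSpline 0 x = (Set.Ico (0 : ℝ) 1).indicator (fun _ => 1) x := by
  rcases lt_or_ge x 0 with hx | hx
  · rw [cardinalBSpline_of_neg 0 hx, Set.indicator_of_notMem fun h => not_lt.2 h.1 hx]
  rcases le_or_gt 1 x with hx' | hx'
  · rw [cardinalBSpline_of_ge 0 (by simpa using hx'),
      Set.indicator_of_notMem fun h => not_lt.2 hx' h.2]
  · rw [Set.indicator_of_mem (show x ∈ Set.Ico (0 : ℝ) 1 from ⟨hx, hx'⟩)]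
    simp [cardinalBSpline, Finset.sum_range_succ, truncPow, hx, hx']

section FourierBSpline

open scoped FourierTransform

/-- The Fourier transform of the indicator of `[0, 1)`, away from `ξ = 0`. -/
noncomputable def unitSymbol (ξ : ℝ) : ℂ :=
  (1 - Complex.exp (-2 * Real.pi * ξ * Complex.I)) / (2 * Real.pi * ξ * Complex.I)

lemma fourier_ofReal_eq (f : ℝ → ℝ) (ξ : ℝ) : 𝓕 (fun x => (f x : ℂ)) ξ =
    ∫ x : ℝ, Complex.exp (-2 * Real.pi * ξ * Complex.I * x) * (f x : ℂ) := by
  rw [Real.fourier_real_eq_integral_exp_smul]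
  refine integral_congr_ae (ae_of_all _ fun x => ?_)
  simp only [smul_eq_mul]
  congr 2
  push_cast
  ring

lemma norm_exp_mul_ofReal (ξ x : ℝ) :
    ‖Complex.exp (-2 * Real.pi * ξ * Complex.I * x)‖ = 1 := by
  rw [show (-2 * Real.pi * ξ * Complex.I * x : ℂ) = ((-2 * Real.pi * ξ * x : ℝ) : ℂ) * Complex.I by
    push_cast; ring, Complex.norm_exp_ofReal_mul_I]

lemma integrable_exp_mul {f : ℝ → ℝ} (hf : Integrable f) (ξ : ℝ) :
    Integrable fun x : ℝ => Complex.exp (-2 * Real.pi * ξ * Complex.I * x) * (f x : ℂ) :=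
  hf.ofReal.bdd_mul (c := 1) (by fun_prop) (ae_of_all _ fun x => (norm_exp_mul_ofReal ξ x).le)

lemma integral_exp_mul_comp_add (f : ℝ → ℝ) (ξ a : ℝ) :
    ∫ x : ℝ, Complex.exp (-2 * Real.pi * ξ * Complex.I * x) * (f (x + a) : ℂ) =
      Complex.exp (2 * Real.pi * ξ * Complex.I * a) *
        ∫ x : ℝ, Complex.exp (-2 * Real.pi * ξ * Complex.I * x) * (f x : ℂ) := by
  rw [← integral_const_mul, ← integral_add_right_eq_self (fun x : ℝ =>
    Complex.exp (2 * Real.pi * ξ * Complex.I * a) *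
      (Complex.exp (-2 * Real.pi * ξ * Complex.I * x) * (f x : ℂ))) a]
  refine integral_congr_ae (ae_of_all _ fun x => ?_)
  simp only
  rw [← mul_assoc, ← Complex.exp_add]
  congr 2
  push_cast
  ring

lemma integrable_cardinalBSpline (m : ℕ) : Integrable (cardinalBSpline m) :=
  memLp_one_iff_integrable.1 (memLp_cardinalBSpline m 1)

lemma two_pi_mul_I_ne_zero {ξ : ℝ} (hξ : ξ ≠ 0) : (2 * Real.pi * ξ * Complex.I : ℂ) ≠ 0 := by
  simp [hξ, Real.pi_ne_zero]

/-- The Fourier transform of `N_m`. In the induction step, the integral of the derivative of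
`x ↦ exp (-2 π i ξ x) N_{m+1}(x)` vanishes; for `m = 0` this function fails to be differentiable at
the knots, which are countably many. -/
lemma integral_exp_mul_cardinalBSpline (m : ℕ) {ξ : ℝ} (hξ : ξ ≠ 0) :
    ∫ x : ℝ, Complex.exp (-2 * Real.pi * ξ * Complex.I * x) * (cardinalBSpline m x : ℂ) =
      unitSymbol ξ ^ (m + 1) := by
  have hc := two_pi_mul_I_ne_zero hξ
  have hc' : (-2 * Real.pi * ξ * Complex.I : ℂ) ≠ 0 := by
    rw [show (-2 * Real.pi * ξ * Complex.I : ℂ) = -(2 * Real.pi * ξ * Complex.I) by ring]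
    exact neg_ne_zero.2 hc
  induction m with
  | zero =>
    have h1 : ∀ x : ℝ, Complex.exp (-2 * Real.pi * ξ * Complex.I * x) *
        (cardinalBSpline 0 x : ℂ) = (Set.Ico (0 : ℝ) 1).indicator
        (fun x => Complex.exp (-2 * Real.pi * ξ * Complex.I * x)) x := fun x => by
      rw [cardinalBSpline_zero]
      by_cases hx : x ∈ Set.Ico (0 : ℝ) 1 <;> simp [hx]
    simp only [h1]
    rw [integral_indicator measurableSet_Ico, integral_Ico_eq_integral_Ioc,
      ← intervalIntegral.integral_of_le zero_le_one, integral_exp_mul_complex hc', unitSymbol]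
    simp only [Complex.ofReal_one, mul_one, Complex.ofReal_zero, mul_zero, Complex.exp_zero,
      zero_add, pow_one]
    rw [div_eq_div_iff hc' hc]
    ring
  | succ m ih =>
    have hderiv : ∀ x ∈ Set.Ioo (min (-1 : ℝ) (m + 3)) (max (-1) (m + 3)) \
        Set.range ((↑) : ℤ → ℝ), HasDerivAt
        (fun x : ℝ => Complex.exp (-2 * Real.pi * ξ * Complex.I * x) *
          (cardinalBSpline (m + 1) x : ℂ))
        ((-2 * Real.pi * ξ * Complex.I) * (Complex.exp (-2 * Real.pi * ξ * Complex.I * x) *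
          (cardinalBSpline (m + 1) x : ℂ)) +
        (Complex.exp (-2 * Real.pi * ξ * Complex.I * x) * (cardinalBSpline m x : ℂ) -
        Complex.exp (-2 * Real.pi * ξ * Complex.I * x) *
          (cardinalBSpline m (x + (-1 : ℝ)) : ℂ))) x := by
      intro x hx
      have h1 := ((Complex.ofRealCLM.hasDerivAt (x := x)).const_mul
        (-2 * Real.pi * ξ * Complex.I : ℂ)).cexp
      have h2 := (hasDerivAt_cardinalBSpline_succ m hx.2).ofReal_comp
      refine (h1.mul h2).congr_deriv ?_
      rw [← sub_eq_add_neg]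
      simp
      ring
    have i1 := integrable_exp_mul (integrable_cardinalBSpline (m + 1)) ξ
    have i2 := integrable_exp_mul (integrable_cardinalBSpline m) ξ
    have i3 := integrable_exp_mul ((integrable_cardinalBSpline m).comp_add_right (-1)) ξ
    have i4 : Integrable fun x : ℝ =>
        Complex.exp (-2 * Real.pi * ξ * Complex.I * x) * (cardinalBSpline m x : ℂ) -
        Complex.exp (-2 * Real.pi * ξ * Complex.I * x) *
          (cardinalBSpline m (x + (-1 : ℝ)) : ℂ) := i2.sub i3
    have hint := (i1.const_mul (-2 * Real.pi * ξ * Complex.I)).add i4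
    have key := integral_eq_of_hasDerivAt_off_countable _ _
      (Set.countable_range ((↑) : ℤ → ℝ)) (Continuous.continuousOn (by
        have := continuous_cardinalBSpline_succ m
        fun_prop)) hderiv hint.intervalIntegrable
    have hsupp : Function.support (fun x : ℝ => (-2 * Real.pi * ξ * Complex.I) *
        (Complex.exp (-2 * Real.pi * ξ * Complex.I * x) * (cardinalBSpline (m + 1) x : ℂ)) +
        (Complex.exp (-2 * Real.pi * ξ * Complex.I * x) * (cardinalBSpline m x : ℂ) -
        Complex.exp (-2 * Real.pi * ξ * Complex.I * x) *
          (cardinalBSpline m (x + (-1 : ℝ)) : ℂ))) ⊆ Set.Ioc (-1 : ℝ) (m + 3) := by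
      intro x hx
      by_contra hcon
      refine hx ?_
      rcases le_or_gt x (-1) with h | h
      · simp only
        rw [cardinalBSpline_of_neg _ (by linarith), cardinalBSpline_of_neg _ (by linarith),
          cardinalBSpline_of_neg _ (by linarith)]
        simp
      · have h' : (m : ℝ) + 3 < x := by
          by_contra h''
          exact hcon ⟨h, not_lt.1 h''⟩
        simp only
        rw [cardinalBSpline_of_ge _ (by push_cast; linarith),
          cardinalBSpline_of_ge _ (by linarith), cardinalBSpline_of_ge _ (by linarith)]
        simp
    rw [intervalIntegral.integral_eq_integral_of_support_subset hsupp,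
      integral_add (i1.const_mul _) i4, integral_sub i2 i3, integral_const_mul,
      integral_exp_mul_comp_add (cardinalBSpline m) ξ (-1), ih,
      cardinalBSpline_of_neg (m + 1) (by norm_num : (-1 : ℝ) < 0),
      cardinalBSpline_of_ge (m + 1) (by push_cast; linarith : ((m + 1 : ℕ) : ℝ) + 1 ≤ m + 3)] at key
    have hq : unitSymbol ξ * (2 * Real.pi * ξ * Complex.I) =
        1 - Complex.exp (-2 * Real.pi * ξ * Complex.I) := div_mul_cancel₀ _ hc
    rw [pow_succ (unitSymbol ξ) (m + 1)]
    refine mul_right_cancel₀ hc ?_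
    have e : Complex.exp (2 * Real.pi * ξ * Complex.I * ((-1 : ℝ) : ℂ)) =
        Complex.exp (-2 * Real.pi * ξ * Complex.I) := by
      congr 1; push_cast; ring
    rw [e] at key
    simp only [Complex.ofReal_zero, mul_zero, sub_zero] at key
    linear_combination -key - unitSymbol ξ ^ (m + 1) * hq

lemma normSq_unitSymbol (ξ : ℝ) : ‖unitSymbol ξ‖ ^ 2 =
    Real.sin (Real.pi * ξ) ^ 2 / Real.pi ^ 2 * (ξ ^ 2)⁻¹ := by
  rw [unitSymbol, norm_div, div_pow, norm_sub_rev]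
  have h := norm_exp_two_pi_sub_one_sq (-ξ)
  rw [mul_neg, Real.sin_neg, neg_sq] at h
  rw [show (-2 * Real.pi * ξ * Complex.I : ℂ) = 2 * Real.pi * ((-ξ : ℝ) : ℂ) * Complex.I by
    push_cast; ring, h]
  have e3 : ‖(2 * Real.pi * ξ * Complex.I : ℂ)‖ ^ 2 = 4 * Real.pi ^ 2 * ξ ^ 2 := by
    rw [show (2 * Real.pi * ξ * Complex.I : ℂ) =
      ((2 * Real.pi * ξ : ℝ) : ℂ) * Complex.I by push_cast; ring, norm_mul,
      Complex.norm_I, Complex.norm_real, mul_one, Real.norm_eq_abs, sq_abs]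
    ring
  rw [e3, mul_assoc 4, mul_div_mul_left _ _ (by norm_num : (4 : ℝ) ≠ 0), div_mul_eq_div_div,
    div_eq_mul_inv _ (ξ ^ 2)]

end FourierBSpline

/-! ### Sums of shifted B-splines -/

/-- The spline `∑ c_γ N_m(x + γ)` of mesh size `1`. -/
noncomputable def shiftSum (m : ℕ) (c : ℤ → ℝ) (x : ℝ) : ℝ :=
  ∑' γ : ℤ, c γ * cardinalBSpline m (x + γ)

/-- The difference of coefficients that corresponds to differentiation. -/
def coeffDiff (c : ℤ → ℝ) (γ : ℤ) : ℝ := c γ - c (γ + 1)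

lemma shiftSum_eq_sum (m : ℕ) (c : ℤ → ℝ) {n : ℤ} {x : ℝ} (hx : x ∈ Set.Ico (n : ℝ) (n + 1)) :
    shiftSum m c x =
      ∑ i ∈ Finset.range (m + 1), c (i - n) * cardinalBSpline m (x + ((i - n : ℤ) : ℝ)) := by
  have hinj : Set.InjOn (fun i : ℕ => (i : ℤ) - n) (Finset.range (m + 1)) := fun a _ b _ h => by
    have : (a : ℤ) - n = b - n := h
    omega
  rw [shiftSum, tsum_eq_sum (s := (Finset.range (m + 1)).image fun i : ℕ => (i : ℤ) - n),
    Finset.sum_image hinj]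
  intro γ hγ
  rcases lt_or_ge (γ + n) 0 with h | h
  · have h' : (γ : ℝ) + n ≤ -1 := by exact_mod_cast (by omega : γ + n ≤ -1)
    rw [cardinalBSpline_of_neg m (by linarith [hx.2]), mul_zero]
  · have h1 : (m : ℤ) + 1 ≤ γ + n := by
      by_contra hcon
      refine hγ (Finset.mem_image.2 ⟨(γ + n).toNat, Finset.mem_range.2 (by omega), ?_⟩)
      simp only [Int.toNat_of_nonneg h]
      omega
    have h' : (m : ℝ) + 1 ≤ γ + n := by exact_mod_cast h1
    rw [cardinalBSpline_of_ge m (by linarith [hx.1]), mul_zero]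

lemma floor_mem_Ico (x : ℝ) : x ∈ Set.Ico (⌊x⌋ : ℝ) (⌊x⌋ + 1) :=
  ⟨Int.floor_le x, Int.lt_floor_add_one x⟩

lemma measurable_shiftSum (m : ℕ) (c : ℤ → ℝ) : Measurable (shiftSum m c) := by
  have h : shiftSum m c = fun x : ℝ => ∑ i ∈ Finset.range (m + 1),
      c (i - ⌊x⌋) * cardinalBSpline m (x + ((i - ⌊x⌋ : ℤ) : ℝ)) :=
    funext fun x => shiftSum_eq_sum m c (floor_mem_Ico x)
  rw [h]
  refine Finset.measurable_sum _ fun i _ => Measurable.mul ?_ ?_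
  · exact (measurable_from_top (f := fun n : ℤ => c (i - n))).comp Int.measurable_floor
  · refine (measurable_cardinalBSpline m).comp (measurable_id.add ?_)
    exact (measurable_from_top (f := fun n : ℤ => ((i - n : ℤ) : ℝ))).comp Int.measurable_floor

lemma hasDerivAt_shiftSum_succ (m : ℕ) (c : ℤ → ℝ) {x : ℝ}
    (hx : x ∉ Set.range ((↑) : ℤ → ℝ)) :
    HasDerivAt (shiftSum (m + 1) c) (shiftSum m (coeffDiff c) x) x := by
  set n := ⌊x⌋ with hn
  have hIco : x ∈ Set.Ico (n : ℝ) (n + 1) := floor_mem_Ico x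
  have hlt : (n : ℝ) < x := lt_of_le_of_ne hIco.1 fun h => hx ⟨n, h⟩
  have hnot : ∀ j : ℤ, x + j ∉ Set.range ((↑) : ℤ → ℝ) := fun j ⟨i, hi⟩ =>
    hx ⟨i - j, by push_cast; linarith⟩
  have h : HasDerivAt (shiftSum (m + 1) c) (∑ i ∈ Finset.range (m + 2), c (i - n) *
      (cardinalBSpline m (x + ((i - n : ℤ) : ℝ)) -
        cardinalBSpline m (x + ((i - n : ℤ) : ℝ) - 1))) x := by
    have h1 : HasDerivAt (fun y => ∑ i ∈ Finset.range (m + 2), c (i - n) *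
        cardinalBSpline (m + 1) (y + ((i - n : ℤ) : ℝ))) (∑ i ∈ Finset.range (m + 2), c (i - n) *
      (cardinalBSpline m (x + ((i - n : ℤ) : ℝ)) -
        cardinalBSpline m (x + ((i - n : ℤ) : ℝ) - 1))) x := by
      refine HasDerivAt.fun_sum fun i _ => HasDerivAt.const_mul _ ?_
      exact (hasDerivAt_cardinalBSpline_succ m (hnot (i - n))).comp_add_const x _
    refine h1.congr_of_eventuallyEq ?_
    filter_upwards [Ioo_mem_nhds hlt hIco.2] with y hy
    exact shiftSum_eq_sum (m + 1) c ⟨hy.1.le, hy.2⟩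
  refine h.congr_deriv ?_
  rw [shiftSum_eq_sum m (coeffDiff c) hIco]
  simp only [mul_sub, Finset.sum_sub_distrib, coeffDiff, sub_mul]
  congr 1
  · rw [Finset.sum_range_succ, cardinalBSpline_of_ge m, mul_zero, add_zero]
    push_cast
    linarith
  · rw [Finset.sum_range_succ']
    rw [cardinalBSpline_of_neg m (by push_cast; linarith [hIco.2]), mul_zero, add_zero]
    refine Finset.sum_congr rfl fun i _ => ?_
    congr 1
    · congr 1; push_cast; ring
    · congr 1; push_cast; ring

lemma isOpen_compl_range_intCast : IsOpen (Set.range ((↑) : ℤ → ℝ))ᶜ :=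
  Int.isClosedEmbedding_coe_real.isClosed_range.isOpen_compl

/-- Off the knots, `k`-fold differentiation takes `k`-th differences of the coefficients. At the
knots the last derivatives need not exist; they form a null set. -/
lemma iteratedDeriv_shiftSum {m k : ℕ} (hk : k ≤ m) (c : ℤ → ℝ) {x : ℝ}
    (hx : x ∉ Set.range ((↑) : ℤ → ℝ)) :
    iteratedDeriv k (shiftSum m c) x = shiftSum (m - k) (coeffDiff^[k] c) x := by
  induction k generalizing x with
  | zero => simp
  | succ k ih =>
    have hev : iteratedDeriv k (shiftSum m c) =ᶠ[𝓝 x] shiftSum (m - k) (coeffDiff^[k] c) := by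
      filter_upwards [isOpen_compl_range_intCast.mem_nhds hx] with y hy using ih (by omega) hy
    rw [iteratedDeriv_succ, hev.deriv_eq, Function.iterate_succ_apply',
      show m - k = (m - (k + 1)) + 1 by omega]
    exact (hasDerivAt_shiftSum_succ _ _ hx).deriv

lemma eLpNorm_two_sq {α E : Type*} [MeasurableSpace α] [NormedAddCommGroup E] (f : α → E)
    (μ : Measure α) : eLpNorm f 2 μ ^ 2 = ∫⁻ x, ‖f x‖ₑ ^ 2 ∂μ := by
  have h := eLpNorm_nnreal_pow_eq_lintegral (f := f) (μ := μ) (p := 2) two_ne_zero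
  simp only [NNReal.coe_ofNat, ENNReal.coe_ofNat] at h
  have e : ∀ a : ENNReal, a ^ (2 : ℝ) = a ^ 2 := fun a => by
    rw [← ENNReal.rpow_natCast]; norm_num
  simpa only [e] using h

/-! ### The Fourier transform of a finite sum of B-splines -/

/-- The symbol `∑ c_γ exp (2 π i γ ξ)` of a sequence of coefficients. -/
noncomputable def symbol (c : ℤ → ℝ) (ξ : ℝ) : ℂ :=
  ∑' γ : ℤ, (c γ : ℂ) * Complex.exp (2 * Real.pi * ξ * Complex.I * γ)

lemma symbol_eq_sum {c : ℤ → ℝ} (hc : (Function.support c).Finite) (ξ : ℝ) : symbol c ξ =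
    ∑ γ ∈ hc.toFinset, (c γ : ℂ) * Complex.exp (2 * Real.pi * ξ * Complex.I * γ) := by
  refine tsum_eq_sum fun γ hγ => ?_
  have : c γ = 0 := by simpa using hγ
  simp [this]

lemma summable_symbol {c : ℤ → ℝ} (hc : (Function.support c).Finite) (ξ : ℝ) :
    Summable fun γ : ℤ => (c γ : ℂ) * Complex.exp (2 * Real.pi * ξ * Complex.I * γ) :=
  summable_of_hasFiniteSupport (hc.subset fun γ hγ h => hγ (by simp [h]))

lemma shiftSum_eq_sum_support (m : ℕ) {c : ℤ → ℝ} (hc : (Function.support c).Finite) :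
    shiftSum m c = fun x => ∑ γ ∈ hc.toFinset, c γ * cardinalBSpline m (x + γ) := by
  refine funext fun x => tsum_eq_sum fun γ hγ => ?_
  have : c γ = 0 := by simpa using hγ
  simp [this]

lemma memLp_shiftSum (m : ℕ) {c : ℤ → ℝ} (hc : (Function.support c).Finite) (p : ENNReal) :
    MemLp (shiftSum m c) p := by
  rw [shiftSum_eq_sum_support m hc]
  refine memLp_finsetSum _ fun γ _ => MemLp.const_mul ?_ _
  exact (memLp_cardinalBSpline m p).comp_measurePreserving
    (measurePreserving_add_right volume (γ : ℝ))

lemma continuous_symbol {c : ℤ → ℝ} (hc : (Function.support c).Finite) :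
    Continuous (symbol c) := by
  rw [funext (symbol_eq_sum hc)]
  fun_prop

lemma symbol_add_intCast (c : ℤ → ℝ) (ξ : ℝ) (l : ℤ) : symbol c (ξ + l) = symbol c ξ := by
  refine tsum_congr fun γ => ?_
  congr 1
  rw [Complex.exp_eq_exp_iff_exists_int]
  exact ⟨l * γ, by push_cast; ring⟩

lemma finite_support_comp_add_one {c : ℤ → ℝ} (hc : (Function.support c).Finite) :
    (Function.support fun γ => c (γ + 1)).Finite :=
  Set.Finite.preimage (f := fun γ : ℤ => γ + 1) (add_left_injective 1).injOn hc

lemma finite_support_coeffDiff {c : ℤ → ℝ} (hc : (Function.support c).Finite) :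
    (Function.support (coeffDiff c)).Finite :=
  (hc.union (finite_support_comp_add_one hc)).subset fun γ hγ => by
    by_contra h
    simp only [Set.mem_union, Function.mem_support, not_or, not_not] at h
    exact hγ (by rw [coeffDiff, h.1, h.2, sub_zero])

lemma finite_support_coeffDiff_iterate {c : ℤ → ℝ} (hc : (Function.support c).Finite) (k : ℕ) :
    (Function.support (coeffDiff^[k] c)).Finite := by
  induction k with
  | zero => exact hc
  | succ k ih => rw [Function.iterate_succ_apply']; exact finite_support_coeffDiff ih

lemma symbol_coeffDiff {c : ℤ → ℝ} (hc : (Function.support c).Finite) (ξ : ℝ) :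
    symbol (coeffDiff c) ξ =
      symbol c ξ * (1 - Complex.exp (-2 * Real.pi * ξ * Complex.I)) := by
  have h1 : symbol (fun γ => c (γ + 1)) ξ =
      symbol c ξ * Complex.exp (-2 * Real.pi * ξ * Complex.I) := by
    rw [symbol, symbol, ← tsum_mul_right,
      ← (Equiv.addRight (1 : ℤ)).tsum_eq (fun γ : ℤ => (c γ : ℂ) *
        Complex.exp (2 * Real.pi * ξ * Complex.I * γ) *
        Complex.exp (-2 * Real.pi * ξ * Complex.I))]
    refine tsum_congr fun γ => ?_
    rw [mul_assoc (c _ : ℂ), ← Complex.exp_add]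
    simp only [Equiv.coe_addRight]
    congr 2
    push_cast
    ring
  rw [mul_sub, mul_one, ← h1, symbol, symbol, symbol, ← (summable_symbol hc ξ).tsum_sub
    (summable_symbol (finite_support_comp_add_one hc) ξ)]
  refine tsum_congr fun γ => ?_
  rw [coeffDiff]
  push_cast
  ring

lemma norm_symbol_coeffDiff_iterate {c : ℤ → ℝ} (hc : (Function.support c).Finite) (k : ℕ)
    (ξ : ℝ) : ‖symbol (coeffDiff^[k] c) ξ‖ ^ 2 =
      ‖symbol c ξ‖ ^ 2 * (4 * Real.sin (Real.pi * ξ) ^ 2) ^ k := by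
  induction k with
  | zero => simp
  | succ k ih =>
    rw [Function.iterate_succ_apply', symbol_coeffDiff (finite_support_coeffDiff_iterate hc k),
      norm_mul, mul_pow, ih, norm_sub_rev]
    have h := norm_exp_two_pi_sub_one_sq (-ξ)
    rw [mul_neg, Real.sin_neg, neg_sq] at h
    rw [show (-2 * Real.pi * ξ * Complex.I : ℂ) = 2 * Real.pi * ((-ξ : ℝ) : ℂ) * Complex.I by
      push_cast; ring, h]
    ring

section

open scoped FourierTransform

lemma fourier_shiftSum (m : ℕ) {c : ℤ → ℝ} (hc : (Function.support c).Finite) {ξ : ℝ}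
    (hξ : ξ ≠ 0) :
    𝓕 (fun x => (shiftSum m c x : ℂ)) ξ = symbol c ξ * unitSymbol ξ ^ (m + 1) := by
  rw [fourier_ofReal_eq, shiftSum_eq_sum_support m hc, symbol_eq_sum hc, Finset.sum_mul]
  have e : ∀ x : ℝ, Complex.exp (-2 * Real.pi * ξ * Complex.I * x) *
      ((∑ γ ∈ hc.toFinset, c γ * cardinalBSpline m (x + γ) : ℝ) : ℂ) =
      ∑ γ ∈ hc.toFinset, (c γ : ℂ) * (Complex.exp (-2 * Real.pi * ξ * Complex.I * x) *
        (cardinalBSpline m (x + γ) : ℂ)) := fun x => by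
    push_cast
    rw [Finset.mul_sum]
    exact Finset.sum_congr rfl fun γ _ => by ring
  simp only [e]
  have hint : ∀ γ ∈ hc.toFinset, Integrable fun x : ℝ => (c γ : ℂ) *
      (Complex.exp (-2 * Real.pi * ξ * Complex.I * x) * (cardinalBSpline m (x + γ) : ℂ)) :=
    fun γ _ => (integrable_exp_mul
      ((integrable_cardinalBSpline m).comp_add_right (γ : ℝ)) ξ).const_mul _
  rw [integral_finsetSum _ hint]
  refine Finset.sum_congr rfl fun γ _ => ?_
  rw [integral_const_mul, integral_exp_mul_comp_add, integral_exp_mul_cardinalBSpline m hξ,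
    ← mul_assoc, Complex.ofReal_intCast]

end

lemma lintegral_eq_lintegral_Ioo_tsum {f : ℝ → ENNReal} (hf : Measurable f) :
    ∫⁻ x, f x = ∫⁻ x in Set.Ioo (0 : ℝ) 1, ∑' l : ℤ, f (x + l) := by
  rw [← setLIntegral_univ, ← iUnion_Ioc_intCast ℝ, lintegral_iUnion (fun _ => measurableSet_Ioc)
    (Set.pairwise_disjoint_Ioc_intCast ℝ), lintegral_tsum fun l => by fun_prop]
  refine tsum_congr fun l => ?_
  rw [← (measurePreserving_add_right volume (l : ℝ)).setLIntegral_comp_preimage measurableSet_Ioc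
    hf, restrict_Ioo_eq_restrict_Ioc, Set.preimage_add_const_Ioc]
  simp

/-- The periodization of `|unitSymbol|²ᵐ⁺²`, on `(0, 1)`: the weight against which `|symbol c|²` is
integrated to give the square of the `L²` norm of `shiftSum m c`. -/
noncomputable def bsplineWeight (m : ℕ) (ξ : ℝ) : ℝ :=
  (Real.sin (Real.pi * ξ) ^ 2 / Real.pi ^ 2) ^ (m + 1) * latticeSum (2 * m + 2) ξ

lemma sin_pi_mul_add_int_sq (ξ : ℝ) (l : ℤ) :
    Real.sin (Real.pi * (ξ + l)) ^ 2 = Real.sin (Real.pi * ξ) ^ 2 := by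
  rw [show Real.pi * (ξ + l) = Real.pi * ξ + l * Real.pi by ring, Real.sin_add_int_mul_pi, mul_pow,
    ← zpow_natCast, ← zpow_mul, mul_comm l, zpow_mul]
  simp

/-- Plancherel's theorem, and unfolding of the integral over the line to one period. -/
lemma lintegral_shiftSum_sq (m : ℕ) {c : ℤ → ℝ} (hc : (Function.support c).Finite) :
    ∫⁻ x, ‖shiftSum m c x‖ₑ ^ 2 =
      ∫⁻ ξ in Set.Ioo (0 : ℝ) 1, ENNReal.ofReal (‖symbol c ξ‖ ^ 2 * bsplineWeight m ξ) := by
  have h1 : Integrable fun x => (shiftSum m c x : ℂ) :=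
    (memLp_one_iff_integrable.1 (memLp_shiftSum m hc 1)).ofReal
  have h2 : MemLp (fun x => (shiftSum m c x : ℂ)) 2 := (memLp_shiftSum m hc 2).ofReal
  have h3 := congrArg (· ^ 2) (eLpNorm_fourier_eq h1 h2)
  simp only [eLpNorm_two_sq] at h3
  have h4 : ∀ x, ‖(shiftSum m c x : ℂ)‖ₑ = ‖shiftSum m c x‖ₑ := fun x => by
    rw [← ofReal_norm, ← ofReal_norm, Complex.norm_real]
  simp only [h4] at h3
  rw [← h3]
  have h5 : ∀ᵐ ξ : ℝ, ξ ≠ 0 := by simp [ae_iff]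
  have hpt : ∀ ξ : ℝ, ‖symbol c ξ * unitSymbol ξ ^ (m + 1)‖ ^ 2 = ‖symbol c ξ‖ ^ 2 *
      ((Real.sin (Real.pi * ξ) ^ 2 / Real.pi ^ 2) ^ (m + 1) * (ξ ^ (2 * m + 2))⁻¹) := fun ξ => by
    rw [norm_mul, norm_pow, mul_pow, ← pow_mul, mul_comm (m + 1) 2, pow_mul, normSq_unitSymbol,
      mul_pow, inv_pow, ← pow_mul, show 2 * (m + 1) = 2 * m + 2 by ring]
  have h6 : ∀ᵐ ξ : ℝ, ‖(FourierTransform.fourier (fun x => (shiftSum m c x : ℂ)) : ℝ → ℂ) ξ‖ₑ ^ 2 =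
      ENNReal.ofReal (‖symbol c ξ‖ ^ 2 *
      ((Real.sin (Real.pi * ξ) ^ 2 / Real.pi ^ 2) ^ (m + 1) * (ξ ^ (2 * m + 2))⁻¹)) := by
    filter_upwards [h5] with ξ hξ
    rw [fourier_shiftSum m hc hξ, ← hpt, ← ofReal_norm, ENNReal.ofReal_pow (norm_nonneg _)]
  rw [lintegral_congr_ae h6, lintegral_eq_lintegral_Ioo_tsum]
  · refine setLIntegral_congr_fun measurableSet_Ioo fun ξ hξ => ?_
    simp only [symbol_add_intCast, sin_pi_mul_add_int_sq]
    have hev : ∀ l : ℤ, 0 ≤ ((ξ + l) ^ (2 * m + 2))⁻¹ := fun l => by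
      rw [show 2 * m + 2 = 2 * (m + 1) by ring, pow_mul]
      positivity
    rw [bsplineWeight, latticeSum, ← tsum_mul_left, ← tsum_mul_left, ENNReal.ofReal_tsum_of_nonneg]
    · exact fun l => mul_nonneg (sq_nonneg _) (mul_nonneg (by positivity) (hev l))
    · exact ((summable_latticeSum (by omega) ξ).mul_left _).mul_left _
  · have := (continuous_symbol hc).measurable
    fun_prop

lemma favard_odd_pos (n : ℕ) : 0 < favard (2 * n + 1) := by
  have h1 := latticeSum_pos (n := n) (t := 1 / 2) (by norm_num)
  rw [favard_odd] at h1
  exact pos_of_mul_pos_right h1 (by positivity)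

lemma bernsteinConst_pos (m k : ℕ) {h : ℝ} (hh : 0 < h) :
    0 < bernsteinConst m k h := by
  have := favard_odd_pos (m - k)
  have := favard_odd_pos m
  have := Real.pi_pos
  unfold bernsteinConst
  positivity

lemma bernsteinConst_eq_mul (m k : ℕ) (h : ℝ) :
    bernsteinConst m k h = h ^ k * bernsteinConst m k 1 := by
  simp only [bernsteinConst, mul_one, mul_pow]
  ring

/-- The square of the sharp constant is the quotient of the weights of the `k`-th derivative and of
the spline at `ξ = 1 / 2`. -/
lemma bernsteinConst_one_sq (n k : ℕ) :
    bernsteinConst (n + k) k 1 ^ 2 * latticeSum (2 * (n + k) + 2) (1 / 2) =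
    Real.pi ^ (2 * k) * 4 ^ k * latticeSum (2 * n + 2) (1 / 2) := by
  have h1 := favard_odd_pos n
  have h2 := favard_odd_pos (n + k)
  have h4 : (4 : ℝ) ^ k = 2 ^ (2 * k) := by rw [pow_mul]; norm_num
  rw [bernsteinConst, mul_one, mul_pow, Nat.add_sub_cancel, Real.sq_sqrt (by positivity),
    favard_odd, favard_odd, h4]
  field_simp
  ring

/-- The pointwise form, in the frequency domain, of the sharp inequality. -/
lemma weight_le (n k : ℕ) {t : ℝ} (ht : t ∈ Set.Ioo (0 : ℝ) 1) :
    (4 * Real.sin (Real.pi * t) ^ 2) ^ k * bsplineWeight n t ≤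
      bernsteinConst (n + k) k 1 ^ 2 * bsplineWeight (n + k) t := by
  have hp : 0 < latticeSum (2 * (n + k) + 2) (1 / 2) := latticeSum_pos (by norm_num)
  refine le_of_mul_le_mul_right ?_ hp
  have h1 := latticeSum_mul_le n k ht
  have h2 := bernsteinConst_one_sq n k
  have h3 : Real.pi ^ (2 * k) * (Real.sin (Real.pi * t) ^ 2 / Real.pi ^ 2) ^ k =
      (Real.sin (Real.pi * t) ^ 2) ^ k := by
    rw [div_pow, ← pow_mul Real.pi, mul_div_cancel₀ _ (by positivity)]
  calc _ = 4 ^ k * Real.pi ^ (2 * k) *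
        (Real.sin (Real.pi * t) ^ 2 / Real.pi ^ 2) ^ (n + k + 1) *
        (latticeSum (2 * n + 2) t * latticeSum (2 * (n + k) + 2) (1 / 2)) := by
        rw [bsplineWeight, mul_pow, ← h3]
        ring
    _ ≤ 4 ^ k * Real.pi ^ (2 * k) *
        (Real.sin (Real.pi * t) ^ 2 / Real.pi ^ 2) ^ (n + k + 1) *
        (latticeSum (2 * n + 2) (1 / 2) * latticeSum (2 * (n + k) + 2) t) :=
        mul_le_mul_of_nonneg_left h1 (by positivity)
    _ = _ := by
        rw [bsplineWeight]
        linear_combination (-(Real.sin (Real.pi * t) ^ 2 / Real.pi ^ 2) ^ (n + k + 1) *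
          latticeSum (2 * (n + k) + 2) t) * h2

/-- The sharp inequality on the unit mesh for finitely many nonzero coefficients. -/
lemma lintegral_shiftSum_coeffDiff_le {m k : ℕ} (hk : k ≤ m) {c : ℤ → ℝ}
    (hc : (Function.support c).Finite) :
    ∫⁻ x, ‖shiftSum (m - k) (coeffDiff^[k] c) x‖ₑ ^ 2 ≤
      ENNReal.ofReal (bernsteinConst m k 1 ^ 2) * ∫⁻ x, ‖shiftSum m c x‖ₑ ^ 2 := by
  obtain ⟨n, rfl⟩ : ∃ n, m = n + k := ⟨m - k, by omega⟩
  rw [Nat.add_sub_cancel, lintegral_shiftSum_sq n (finite_support_coeffDiff_iterate hc k),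
    lintegral_shiftSum_sq (n + k) hc, ← lintegral_const_mul' _ _ ENNReal.ofReal_ne_top]
  refine setLIntegral_mono' measurableSet_Ioo fun ξ hξ => ?_
  rw [← ENNReal.ofReal_mul (sq_nonneg _), norm_symbol_coeffDiff_iterate hc]
  refine ENNReal.ofReal_le_ofReal ?_
  have := mul_le_mul_of_nonneg_left (weight_le n k hξ) (sq_nonneg ‖symbol c ξ‖)
  linarith

/-! ### Local stability of the B-spline basis -/

/-- The Cox–de Boor recursion. -/
lemma cardinalBSpline_succ (m : ℕ) (x : ℝ) : ((m : ℝ) + 1) * cardinalBSpline (m + 1) x =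
    x * cardinalBSpline m x + ((m : ℝ) + 2 - x) * cardinalBSpline m (x - 1) := by
  have hT : ∀ y, truncPow (m + 1) y = y * truncPow m y := fun y => by
    rw [truncPow, truncPow]
    split_ifs <;> ring
  have e3 : ∑ j ∈ Finset.range (m + 2), (-1 : ℝ) ^ j * ((m + 1).choose j : ℝ) *
      truncPow m (x - j) = ∑ j ∈ Finset.range (m + 3), (-1 : ℝ) ^ j * ((m + 1).choose j : ℝ) *
      truncPow m (x - j) := by
    rw [Finset.sum_range_succ _ (m + 2), Nat.choose_eq_zero_of_lt (by omega : m + 1 < m + 2)]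
    simp
  have key : ∑ j ∈ Finset.range (m + 3), (-1 : ℝ) ^ j * ((m + 2).choose j : ℝ) *
      truncPow (m + 1) (x - j) = x * ∑ j ∈ Finset.range (m + 2), (-1 : ℝ) ^ j *
      ((m + 1).choose j : ℝ) * truncPow m (x - j) + ((m : ℝ) + 2 - x) *
      ∑ j ∈ Finset.range (m + 2), (-1 : ℝ) ^ j * ((m + 1).choose j : ℝ) *
      truncPow m (x - 1 - j) := by
    rw [e3, Finset.sum_range_succ' _ (m + 2), Finset.sum_range_succ' _ (m + 2), mul_add,
      Finset.mul_sum, Finset.mul_sum, add_right_comm, ← Finset.sum_add_distrib]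
    congr 1
    · refine Finset.sum_congr rfl fun j _ => ?_
      have hch : ((m : ℝ) + 2) * ((m + 1).choose j : ℝ) =
          ((m + 2).choose (j + 1) : ℝ) * (j + 1) := by
        have := Nat.add_one_mul_choose_eq (m + 1) j
        have h2 := congrArg (Nat.cast (R := ℝ)) this
        push_cast at h2
        linarith
      have hP : ((m + 2).choose (j + 1) : ℝ) =
          ((m + 1).choose j : ℝ) + ((m + 1).choose (j + 1) : ℝ) := by
        exact_mod_cast Nat.choose_succ_succ (m + 1) j
      rw [hT, show x - 1 - (j : ℝ) = x - ((j + 1 : ℕ) : ℝ) by push_cast; ring, pow_succ]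
      rw [hP] at hch ⊢
      push_cast
      linear_combination (-(-1 : ℝ) ^ j * truncPow m (x - ((j : ℝ) + 1))) * hch
    · rw [hT]
      simp
  rw [cardinalBSpline, cardinalBSpline, cardinalBSpline, key, Nat.factorial_succ]
  have : (m.factorial : ℝ) ≠ 0 := by positivity
  have : ((m : ℝ) + 1) ≠ 0 := by positivity
  push_cast
  field_simp

lemma cardinalBSpline_nonneg (m : ℕ) (x : ℝ) : 0 ≤ cardinalBSpline m x := by
  induction m generalizing x with
  | zero => rw [cardinalBSpline_zero]; exact Set.indicator_nonneg (fun _ _ => zero_le_one) _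
  | succ m ih =>
    rcases lt_or_ge x 0 with hx | hx
    · exact (cardinalBSpline_of_neg _ hx).ge
    rcases le_or_gt (((m + 1 : ℕ) : ℝ) + 1) x with hx' | hx'
    · exact (cardinalBSpline_of_ge _ hx').ge
    push_cast at hx'
    have h := cardinalBSpline_succ m x
    have h1 := mul_nonneg hx (ih x)
    have h2 := mul_nonneg (by linarith : (0 : ℝ) ≤ m + 2 - x) (ih (x - 1))
    exact nonneg_of_mul_nonneg_right (by rw [h]; positivity) (by positivity : (0 : ℝ) < m + 1)

/-- Strict positivity inside the support, at points that are not knots. -/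
lemma cardinalBSpline_pos (m : ℕ) {y : ℝ} (hy : y ∈ Set.Ioo (0 : ℝ) 1) {i : ℕ} (hi : i ≤ m) :
    0 < cardinalBSpline m (y + i) := by
  induction m generalizing i with
  | zero =>
    obtain rfl : i = 0 := by omega
    rw [cardinalBSpline_zero, Set.indicator_of_mem]
    · exact zero_lt_one
    · simpa using ⟨hy.1.le, hy.2⟩
  | succ m ih =>
    have h := cardinalBSpline_succ m (y + i)
    have hi' : (i : ℝ) ≤ m + 1 := by exact_mod_cast hi
    have hi0 : (0 : ℝ) ≤ i := Nat.cast_nonneg i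
    have hx1 : 0 < y + i := by linarith [hy.1]
    have hx2 : 0 < (m : ℝ) + 2 - (y + i) := by linarith [hy.2]
    have n1 := mul_nonneg hx1.le (cardinalBSpline_nonneg m (y + i))
    have n2 := mul_nonneg hx2.le (cardinalBSpline_nonneg m (y + i - 1))
    have : 0 < (y + i) * cardinalBSpline m (y + i) +
        ((m : ℝ) + 2 - (y + i)) * cardinalBSpline m (y + i - 1) := by
      rcases Nat.lt_or_ge m i with h' | h'
      · have h3 := ih (i := i - 1) (by omega)
        have e : y + ((i - 1 : ℕ) : ℝ) = y + i - 1 := by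
          rw [Nat.cast_sub (by omega)]; push_cast; ring
        rw [e] at h3
        have := mul_pos hx2 h3
        linarith
      · have := mul_pos hx1 (ih h')
        linarith
    rw [← h] at this
    exact pos_of_mul_pos_right this (by positivity)

lemma notMem_range_intCast {y : ℝ} (hy : y ∈ Set.Ioo (0 : ℝ) 1) :
    y ∉ Set.range ((↑) : ℤ → ℝ) := fun ⟨l, hl⟩ => by
  have := add_int_ne_zero hy (-l)
  push_cast at this
  exact this (by linarith)

lemma shiftSum_eq_sum_Ioo (m : ℕ) (c : ℤ → ℝ) {y : ℝ} (hy : y ∈ Set.Ioo (0 : ℝ) 1) :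
    shiftSum m c y = ∑ i ∈ Finset.range (m + 1), c i * cardinalBSpline m (y + i) := by
  rw [shiftSum_eq_sum m c (n := 0) (x := y) (by simpa using ⟨hy.1.le, hy.2⟩)]
  simp

/-- The B-splines that do not vanish on `(0, 1)` are linearly independent there: after
differentiation the coefficients are constant, and the sum of the B-splines is positive. -/
lemma eq_zero_of_shiftSum_eq_zero (m : ℕ) (c : ℤ → ℝ)
    (h : ∀ y ∈ Set.Ioo (0 : ℝ) 1, shiftSum m c y = 0) {i : ℕ} (hi : i ≤ m) : c i = 0 := by
  have hh : (1 / 2 : ℝ) ∈ Set.Ioo (0 : ℝ) 1 := by norm_num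
  induction m generalizing c i with
  | zero =>
    obtain rfl : i = 0 := by omega
    have h1 := h _ hh
    rw [shiftSum_eq_sum_Ioo 0 c hh] at h1
    have h2 := cardinalBSpline_pos 0 hh (le_refl 0)
    rw [zero_add, Finset.sum_range_one] at h1
    exact (mul_eq_zero.1 h1).resolve_right h2.ne'
  | succ m ih =>
    have h1 : ∀ y ∈ Set.Ioo (0 : ℝ) 1, shiftSum m (coeffDiff c) y = 0 := fun y hy => by
      refine (hasDerivAt_shiftSum_succ m c (notMem_range_intCast hy)).unique ?_
      refine (hasDerivAt_const y (0 : ℝ)).congr_of_eventuallyEq ?_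
      filter_upwards [isOpen_Ioo.mem_nhds hy] with z hz using h z hz
    have h2 : ∀ j : ℕ, j ≤ m + 1 → c j = c 0 := fun j hj => by
      induction j with
      | zero => rfl
      | succ j ihj =>
        have := ih (coeffDiff c) h1 (i := j) (by omega)
        rw [coeffDiff, sub_eq_zero] at this
        push_cast
        rw [← this, ihj (by omega)]
    have h3 := h _ hh
    rw [shiftSum_eq_sum_Ioo (m + 1) c hh, Finset.sum_congr rfl fun j hj => by
      rw [h2 j (Nat.lt_succ_iff.1 (Finset.mem_range.1 hj))], ← Finset.mul_sum] at h3
    have h4 : 0 < ∑ j ∈ Finset.range (m + 2), cardinalBSpline (m + 1) (1 / 2 + j) :=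
      Finset.sum_pos (fun j hj => cardinalBSpline_pos _ hh
        (Nat.lt_succ_iff.1 (Finset.mem_range.1 hj))) ⟨0, by simp⟩
    rw [h2 i hi]
    exact (mul_eq_zero.1 h3).resolve_right h4.ne'

lemma continuousOn_shiftSum (m : ℕ) (c : ℤ → ℝ) : ContinuousOn (shiftSum m c) (Set.Ioo 0 1) := by
  rcases m with _ | m
  · refine (continuousOn_const (c := c 0)).congr fun y hy => ?_
    rw [shiftSum_eq_sum_Ioo 0 c hy, zero_add, Finset.sum_range_one, cardinalBSpline_zero,
      Set.indicator_of_mem]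
    · simp
    · simpa using ⟨hy.1.le, hy.2⟩
  · exact fun y hy => (hasDerivAt_shiftSum_succ m c
      (notMem_range_intCast hy)).continuousAt.continuousWithinAt

/-- A coefficient is controlled by the spline on a single interval between knots. -/
lemma exists_enorm_coeff_sq_le (m : ℕ) : ∃ A : ENNReal, A ≠ ⊤ ∧ ∀ c : ℤ → ℝ,
    ‖c 0‖ₑ ^ 2 ≤ A * ∫⁻ y in Set.Ioo (0 : ℝ) 1, ‖shiftSum m c y‖ₑ ^ 2 := by
  have hmem : ∀ i : Fin (m + 1), MemLp (fun y : ℝ => cardinalBSpline m (y + (i : ℕ))) 2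
      (volume.restrict (Set.Ioo (0 : ℝ) 1)) := fun i =>
    ((memLp_cardinalBSpline m 2).comp_measurePreserving
      (measurePreserving_add_right volume _)).restrict _
  let L : (Fin (m + 1) → ℝ) →ₗ[ℝ] Lp ℝ 2 (volume.restrict (Set.Ioo (0 : ℝ) 1)) :=
    Fintype.linearCombination ℝ fun i => (hmem i).toLp
  -- extension of a finite vector of coefficients by zero
  let ext : (Fin (m + 1) → ℝ) → ℤ → ℝ := fun d γ =>
    if h : 0 ≤ γ ∧ γ.toNat < m + 1 then d ⟨γ.toNat, h.2⟩ else 0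
  have hext : ∀ d (i : Fin (m + 1)), ext d (i : ℕ) = d i := fun d i => by
    simpa [ext] using fun h : m < (i : ℕ) => absurd i.2 (by omega)
  have hL : ∀ d (c : ℤ → ℝ), (∀ i : Fin (m + 1), c (i : ℕ) = d i) →
      (L d : ℝ → ℝ) =ᵐ[volume.restrict (Set.Ioo (0 : ℝ) 1)] shiftSum m c := by
    intro d c hcd
    have h1 : L d = ∑ i, d i • (hmem i).toLp := rfl
    rw [h1]
    have h2 := Lp.coeFn_finsetSum Finset.univ fun i => d i • (hmem i).toLp
    have h3 : ∀ᵐ y ∂(volume.restrict (Set.Ioo (0 : ℝ) 1)), ∀ i : Fin (m + 1),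
        (d i • (hmem i).toLp : Lp ℝ 2 _) y = d i * cardinalBSpline m (y + (i : ℕ)) := by
      rw [ae_all_iff]
      intro i
      filter_upwards [Lp.coeFn_smul (d i) (hmem i).toLp, (hmem i).coeFn_toLp] with y e1 e2
      rw [e1, Pi.smul_apply, e2, smul_eq_mul]
    filter_upwards [h2, h3, ae_restrict_mem measurableSet_Ioo] with y e2 e3 hy
    rw [e2, shiftSum_eq_sum_Ioo m c hy, Finset.sum_apply, Finset.sum_range]
    exact Finset.sum_congr rfl fun i _ => by rw [e3 i, hcd i]
  have hker : LinearMap.ker L = ⊥ := by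
    rw [LinearMap.ker_eq_bot']
    intro d hd
    have h1 : shiftSum m (ext d) =ᵐ[volume.restrict (Set.Ioo (0 : ℝ) 1)] fun _ => 0 := by
      refine (hL d (ext d) (hext d)).symm.trans ?_
      rw [hd]
      exact Lp.coeFn_zero _ _ _
    have h2 := Measure.eqOn_Ioo_of_ae_eq (a := (0 : ℝ)) (b := 1) (μ := volume) h1
      (continuousOn_shiftSum m _) continuousOn_const
    funext i
    have := eq_zero_of_shiftSum_eq_zero m (ext d) h2 (Nat.lt_succ_iff.1 i.2)
    rwa [hext] at this
  -- an injective linear map on a finite-dimensional space is bounded below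
  obtain ⟨K, -, hK⟩ := L.exists_antilipschitzWith hker
  refine ⟨(K : ENNReal) ^ 2, by simp, fun c => ?_⟩
  have h1 := hK (fun i : Fin (m + 1) => c (i : ℕ)) 0
  have h2 := edist_le_pi_edist (fun i : Fin (m + 1) => c (i : ℕ)) 0 0
  rw [map_zero, edist_zero_right, edist_zero_right, Lp.enorm_def,
    eLpNorm_congr_ae (hL _ c fun i => rfl)] at h1
  rw [Pi.zero_apply, edist_zero_right, edist_zero_right] at h2
  rw [← eLpNorm_two_sq, ← mul_pow]
  exact pow_le_pow_left' (h2.trans h1) 2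

lemma shiftSum_comp_add (m : ℕ) (c : ℤ → ℝ) (n : ℤ) (x : ℝ) :
    shiftSum m (fun γ => c (γ + n)) x = shiftSum m c (x - n) := by
  rw [shiftSum, shiftSum, ← (Equiv.addRight n).tsum_eq fun γ : ℤ =>
    c γ * cardinalBSpline m (x - n + γ)]
  refine tsum_congr fun γ => ?_
  simp only [Equiv.coe_addRight]
  congr 2
  push_cast
  ring

lemma lintegral_shiftSum_eq_tsum (m : ℕ) (c : ℤ → ℝ) : ∫⁻ x, ‖shiftSum m c x‖ₑ ^ 2 =
    ∑' n : ℤ, ∫⁻ y in Set.Ioo (0 : ℝ) 1, ‖shiftSum m (fun γ => c (γ + n)) y‖ₑ ^ 2 := by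
  have hm : ∀ c', Measurable fun y => ‖shiftSum m c' y‖ₑ ^ 2 := fun c' =>
    (measurable_shiftSum m c').enorm.pow_const 2
  rw [lintegral_eq_lintegral_Ioo_tsum (hm c), ← lintegral_tsum fun n => (hm _).aemeasurable]
  refine lintegral_congr fun y => ?_
  rw [← (Equiv.neg ℤ).tsum_eq]
  refine tsum_congr fun n => ?_
  rw [shiftSum_comp_add, Equiv.neg_apply]
  push_cast
  rw [sub_eq_add_neg]

/-- The coefficients of a square integrable spline are square summable. -/
lemma exists_tsum_coeff_sq_le (m : ℕ) : ∃ A : ENNReal, A ≠ ⊤ ∧ ∀ c : ℤ → ℝ,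
    ∑' n : ℤ, ‖c n‖ₑ ^ 2 ≤ A * ∫⁻ x, ‖shiftSum m c x‖ₑ ^ 2 := by
  obtain ⟨A, hA, h⟩ := exists_enorm_coeff_sq_le m
  refine ⟨A, hA, fun c => ?_⟩
  rw [lintegral_shiftSum_eq_tsum, ← ENNReal.tsum_mul_left]
  refine ENNReal.tsum_le_tsum fun n => ?_
  simpa using h fun γ => c (γ + n)

lemma exists_lintegral_shiftSum_le (m : ℕ) : ∃ A : ENNReal, A ≠ ⊤ ∧ ∀ c : ℤ → ℝ,
    ∫⁻ x, ‖shiftSum m c x‖ₑ ^ 2 ≤ A * ∑' n : ℤ, ‖c n‖ₑ ^ 2 := by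
  obtain ⟨B, hB0, hB⟩ := exists_bound_cardinalBSpline m
  refine ⟨(m + 1 : ℕ) * (ENNReal.ofReal ((m + 1 : ℕ) * B ^ 2)),
    ENNReal.mul_ne_top (ENNReal.natCast_ne_top _) ENNReal.ofReal_ne_top, fun c => ?_⟩
  have h1 : ∀ (c : ℤ → ℝ) (y : ℝ), y ∈ Set.Ioo (0 : ℝ) 1 → ‖shiftSum m c y‖ₑ ^ 2 ≤
      ENNReal.ofReal ((m + 1 : ℕ) * B ^ 2) * ∑ i ∈ Finset.range (m + 1), ‖c i‖ₑ ^ 2 := by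
    intro c y hy
    have h2 : (shiftSum m c y) ^ 2 ≤
        ((m + 1 : ℕ) * B ^ 2) * ∑ i ∈ Finset.range (m + 1), (c i) ^ 2 := by
      rw [shiftSum_eq_sum_Ioo m c hy]
      refine (sq_sum_le_card_mul_sum_sq).trans ?_
      rw [Finset.card_range, mul_assoc]
      refine mul_le_mul_of_nonneg_left ?_ (Nat.cast_nonneg _)
      rw [Finset.mul_sum]
      refine Finset.sum_le_sum fun i _ => ?_
      rw [mul_pow, mul_comm]
      refine mul_le_mul_of_nonneg_right ?_ (sq_nonneg _)
      rw [← sq_abs]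
      exact pow_le_pow_left₀ (abs_nonneg _) (hB _) 2
    have e : ∀ a : ℝ, ‖a‖ₑ ^ 2 = ENNReal.ofReal (a ^ 2) := fun a => by
      rw [← ofReal_norm, ← ENNReal.ofReal_pow (norm_nonneg _), Real.norm_eq_abs, sq_abs]
    simp only [e]
    rw [← ENNReal.ofReal_sum_of_nonneg fun i _ => sq_nonneg _,
      ← ENNReal.ofReal_mul (by positivity)]
    exact ENNReal.ofReal_le_ofReal h2
  have h3 : ∀ c : ℤ → ℝ, ∫⁻ y in Set.Ioo (0 : ℝ) 1, ‖shiftSum m c y‖ₑ ^ 2 ≤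
      ENNReal.ofReal ((m + 1 : ℕ) * B ^ 2) * ∑ i ∈ Finset.range (m + 1), ‖c i‖ₑ ^ 2 := by
    intro c
    refine (setLIntegral_mono' measurableSet_Ioo (h1 c)).trans ?_
    rw [lintegral_const]
    simp
  rw [lintegral_shiftSum_eq_tsum]
  refine (ENNReal.tsum_le_tsum fun n => h3 _).trans ?_
  rw [ENNReal.tsum_mul_left, Summable.tsum_finsetSum fun _ _ => ENNReal.summable]
  have h4 : ∀ i : ℕ, ∑' n : ℤ, ‖c (i + n)‖ₑ ^ 2 = ∑' n : ℤ, ‖c n‖ₑ ^ 2 := fun i =>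
    (Equiv.addLeft (i : ℤ)).tsum_eq fun n : ℤ => ‖c n‖ₑ ^ 2
  simp only [h4, Finset.sum_const, Finset.card_range, nsmul_eq_mul]
  rw [← mul_assoc, mul_comm (ENNReal.ofReal _)]

/-! ### From finitely supported to square integrable splines -/

/-- The coefficients `c_γ` with `|γ| ≤ N`, all others being replaced by `0`. -/
noncomputable def truncCoeff (c : ℤ → ℝ) (N : ℕ) (γ : ℤ) : ℝ :=
  if γ ∈ Finset.Icc (-N : ℤ) N then c γ else 0

lemma finite_support_truncCoeff (c : ℤ → ℝ) (N : ℕ) :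
    (Function.support (truncCoeff c N)).Finite :=
  (Finset.Icc (-N : ℤ) N).finite_toSet.subset fun γ hγ => by
    by_contra h
    exact hγ (if_neg h)

lemma coeffDiff_iterate_truncCoeff (c : ℤ → ℝ) (k : ℕ) {γ : ℤ} {N : ℕ} (h1 : -N ≤ γ)
    (h2 : γ + k ≤ N) : coeffDiff^[k] (truncCoeff c N) γ = coeffDiff^[k] c γ := by
  induction k generalizing γ with
  | zero => exact if_pos (Finset.mem_Icc.2 ⟨h1, by simpa using h2⟩)
  | succ k ih =>
    push_cast at h2
    rw [Function.iterate_succ_apply', Function.iterate_succ_apply', coeffDiff, coeffDiff,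
      ih h1 (by omega), ih (by omega) (by omega)]

lemma shiftSum_add (m : ℕ) (c d : ℤ → ℝ) (x : ℝ) :
    shiftSum m (fun γ => c γ + d γ) x = shiftSum m c x + shiftSum m d x := by
  simp only [shiftSum_eq_sum m _ (floor_mem_Ico x), add_mul, Finset.sum_add_distrib]

lemma tendsto_tsum_sub_truncCoeff {c : ℤ → ℝ} (hc : ∑' n : ℤ, ‖c n‖ₑ ^ 2 ≠ ⊤) :
    Tendsto (fun N : ℕ => ∑' n : ℤ, ‖c n - truncCoeff c N n‖ₑ ^ 2) atTop (𝓝 0) := by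
  have hS : Tendsto (fun N : ℕ => Finset.Icc (-N : ℤ) N) atTop atTop :=
    Finset.tendsto_Icc_neg.comp tendsto_natCast_atTop_atTop
  refine ((ENNReal.tendsto_tsum_compl_atTop_zero hc).comp hS).congr fun N => ?_
  rw [Function.comp]
  refine (tsum_subtype {n : ℤ | n ∉ Finset.Icc (-N : ℤ) N} fun n : ℤ => ‖c n‖ₑ ^ 2).trans
    (tsum_congr fun n => ?_)
  by_cases hn : n ∈ Finset.Icc (-N : ℤ) N
  · rw [Set.indicator_of_notMem (show n ∉ {n : ℤ | n ∉ Finset.Icc (-N : ℤ) N} from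
      fun h => h hn), truncCoeff, if_pos hn]
    simp
  · rw [Set.indicator_of_mem (show n ∈ {n : ℤ | n ∉ Finset.Icc (-N : ℤ) N} from hn), truncCoeff,
      if_neg hn, sub_zero]

/-- The sharp inequality on the unit mesh. Truncation of the coefficients is legitimate because a
square integrable spline has square summable coefficients. -/
lemma eLpNorm_shiftSum_coeffDiff_le {m k : ℕ} (hk : k ≤ m) (c : ℤ → ℝ) :
    eLpNorm (shiftSum (m - k) (coeffDiff^[k] c)) 2 volume ≤
      ENNReal.ofReal (bernsteinConst m k 1) * eLpNorm (shiftSum m c) 2 volume := by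
  have hK := bernsteinConst_pos m k one_pos
  by_cases htop : eLpNorm (shiftSum m c) 2 volume = ⊤
  · -- the constant is positive, so the right side is infinite, not `0 * ⊤ = 0`
    rw [htop, ENNReal.mul_top (by simpa using hK)]
    exact le_top
  have hfin : ∀ N, eLpNorm (shiftSum (m - k) (coeffDiff^[k] (truncCoeff c N))) 2 volume ≤
      ENNReal.ofReal (bernsteinConst m k 1) * eLpNorm (shiftSum m (truncCoeff c N)) 2 volume := by
    intro N
    have h := lintegral_shiftSum_coeffDiff_le hk (finite_support_truncCoeff c N)
    rw [← eLpNorm_two_sq, ← eLpNorm_two_sq, ENNReal.ofReal_pow hK.le, ← mul_pow] at h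
    exact (ENNReal.pow_le_pow_left_iff two_ne_zero).1 h
  obtain ⟨A, hA, hlow⟩ := exists_tsum_coeff_sq_le m
  obtain ⟨A', hA', hup⟩ := exists_lintegral_shiftSum_le m
  have hsum : ∑' n : ℤ, ‖c n‖ₑ ^ 2 ≠ ⊤ := by
    refine ne_top_of_le_ne_top ?_ (hlow c)
    rw [← eLpNorm_two_sq]
    exact ENNReal.mul_ne_top hA (ENNReal.pow_ne_top htop)
  have htail : Tendsto (fun N : ℕ =>
      eLpNorm (shiftSum m fun n => truncCoeff c N n - c n) 2 volume) atTop (𝓝 0) := by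
    have h1 : Tendsto (fun N : ℕ => A' * ∑' n : ℤ, ‖c n - truncCoeff c N n‖ₑ ^ 2) atTop
        (𝓝 0) := by
      simpa using ENNReal.Tendsto.const_mul (tendsto_tsum_sub_truncCoeff hsum) (Or.inr hA')
    have h2 : Tendsto (fun N : ℕ =>
        eLpNorm (shiftSum m fun n => truncCoeff c N n - c n) 2 volume ^ 2) atTop (𝓝 0) := by
      refine tendsto_of_tendsto_of_tendsto_of_le_of_le tendsto_const_nhds h1
        (fun _ => bot_le) fun N => ?_
      simp only
      rw [eLpNorm_two_sq]
      refine (hup _).trans_eq ?_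
      simp only [enorm_sub_rev]
    have h3 := (ENNReal.continuous_rpow_const (y := 1 / 2)).tendsto 0 |>.comp h2
    rw [ENNReal.zero_rpow_of_pos (by norm_num)] at h3
    refine h3.congr fun N => ?_
    rw [Function.comp, ← ENNReal.rpow_natCast, ← ENNReal.rpow_mul]
    norm_num
  have hlim : ∀ x, Tendsto (fun N : ℕ =>
      shiftSum (m - k) (coeffDiff^[k] (truncCoeff c N)) x) atTop
      (𝓝 (shiftSum (m - k) (coeffDiff^[k] c) x)) := by
    intro x
    refine tendsto_const_nhds.congr' ?_
    filter_upwards [eventually_ge_atTop (⌊x⌋.natAbs + m + k)] with N hN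
    rw [shiftSum_eq_sum _ _ (floor_mem_Ico x), shiftSum_eq_sum _ _ (floor_mem_Ico x)]
    refine Finset.sum_congr rfl fun i hi => ?_
    have := Finset.mem_range.1 hi
    rw [coeffDiff_iterate_truncCoeff c k (by omega) (by omega)]
  have hFatou := Lp.eLpNorm_lim_le_liminf_eLpNorm (p := 2) (μ := volume)
    (fun N : ℕ => (measurable_shiftSum (m - k)
      (coeffDiff^[k] (truncCoeff c N))).aestronglyMeasurable)
    _ (ae_of_all _ hlim)
  refine hFatou.trans ?_
  have hbound : ∀ N : ℕ, eLpNorm (shiftSum (m - k) (coeffDiff^[k] (truncCoeff c N))) 2 volume ≤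
      ENNReal.ofReal (bernsteinConst m k 1) * (eLpNorm (shiftSum m c) 2 volume +
        eLpNorm (shiftSum m fun n => truncCoeff c N n - c n) 2 volume) := by
    intro N
    refine (hfin N).trans (mul_le_mul_right ?_ _)
    have e : shiftSum m (truncCoeff c N) =
        shiftSum m c + shiftSum m fun n => truncCoeff c N n - c n := by
      funext x
      rw [Pi.add_apply, ← shiftSum_add]
      congr 1
      funext n
      ring
    rw [e]
    exact eLpNorm_add_le (measurable_shiftSum _ _).aestronglyMeasurable
      (measurable_shiftSum _ _).aestronglyMeasurable one_le_two
  have hT : Tendsto (fun N : ℕ => ENNReal.ofReal (bernsteinConst m k 1) *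
      (eLpNorm (shiftSum m c) 2 volume +
        eLpNorm (shiftSum m fun n => truncCoeff c N n - c n) 2 volume)) atTop
      (𝓝 (ENNReal.ofReal (bernsteinConst m k 1) * eLpNorm (shiftSum m c) 2 volume)) := by
    have := ENNReal.Tendsto.const_mul (a := ENNReal.ofReal (bernsteinConst m k 1))
      (tendsto_const_nhds (x := eLpNorm (shiftSum m c) 2 volume) |>.add htail)
      (Or.inr ENNReal.ofReal_ne_top)
    simpa using this
  rw [← hT.liminf_eq]
  exact liminf_le_liminf (Eventually.of_forall hbound)

/-! ### Sharpness on the unit mesh -/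

lemma bsplineWeight_nonneg (m : ℕ) (ξ : ℝ) : 0 ≤ bsplineWeight m ξ := by
  refine mul_nonneg (by positivity) (tsum_nonneg fun l => ?_)
  rw [show 2 * m + 2 = 2 * (m + 1) by ring, pow_mul]
  positivity

lemma bsplineWeight_half_pos (m : ℕ) : 0 < bsplineWeight m (1 / 2) := by
  have hh : (1 / 2 : ℝ) ∈ Set.Ioo (0 : ℝ) 1 := by norm_num
  have := sin_pi_mul_pos hh
  have := latticeSum_pos (n := m) hh
  have := Real.pi_pos
  rw [bsplineWeight]
  positivity

lemma continuousOn_bsplineWeight (m : ℕ) : ContinuousOn (bsplineWeight m) (Set.Ioo 0 1) := by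
  refine ContinuousOn.mul (by fun_prop) fun ξ hξ => ?_
  exact (hasDerivAt_latticeSum (by omega) hξ).continuousAt.continuousWithinAt

/-- The coefficients of a single B-spline. -/
def unitCoeff (γ : ℤ) : ℝ := if γ = 0 then 1 else 0

lemma finite_support_unitCoeff : (Function.support unitCoeff).Finite :=
  (Set.finite_singleton (0 : ℤ)).subset fun γ hγ => by
    by_contra h
    exact hγ (if_neg h)

lemma symbol_unitCoeff (ξ : ℝ) : symbol unitCoeff ξ = 1 := by
  rw [symbol, tsum_eq_single 0]
  · simp [unitCoeff]
  · intro γ hγ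
    simp [unitCoeff, hγ]

lemma integrableOn_bsplineWeight (m : ℕ) : IntegrableOn (bsplineWeight m) (Set.Ioo 0 1) := by
  refine ⟨(continuousOn_bsplineWeight m).aestronglyMeasurable measurableSet_Ioo, ?_⟩
  rw [hasFiniteIntegral_iff_ofReal (ae_of_all _ (bsplineWeight_nonneg m))]
  have h1 := lintegral_shiftSum_sq m finite_support_unitCoeff
  simp only [symbol_unitCoeff, norm_one, one_pow, one_mul] at h1
  rw [← h1, ← eLpNorm_two_sq]
  exact ENNReal.pow_lt_top (memLp_shiftSum m finite_support_unitCoeff 2).2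

/-- The `p`-th differences of a B-spline have symbols with `|·|² = (4 sin² (π ξ))ᵖ`, which
concentrate at the frequency `ξ = 1 / 2` where the quotient of the weights is largest. -/
lemma bernsteinConst_le_of_forall {m k : ℕ} (hk : k ≤ m) {C : ℝ} (hC : 0 ≤ C)
    (h : ∀ c : ℤ → ℝ, (Function.support c).Finite →
      eLpNorm (shiftSum (m - k) (coeffDiff^[k] c)) 2 volume ≤
        ENNReal.ofReal C * eLpNorm (shiftSum m c) 2 volume) :
    bernsteinConst m k 1 ≤ C := by
  obtain ⟨n, rfl⟩ : ∃ n, m = n + k := ⟨m - k, by omega⟩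
  rw [Nat.add_sub_cancel] at h
  set u : ℝ → ℝ := fun ξ => 4 * Real.sin (Real.pi * ξ) ^ 2 with hu
  have hu0 : ∀ ξ, 0 ≤ u ξ := fun ξ => by positivity
  have huc : Continuous u := by fun_prop
  have hu4 : ∀ ξ, u ξ ≤ 4 := fun ξ => by
    have := Real.sin_sq_le_one (Real.pi * ξ)
    simp only [hu]
    linarith
  have hint : ∀ (p m : ℕ), IntegrableOn (fun ξ => u ξ ^ p * bsplineWeight m ξ)
      (Set.Ioo 0 1) := fun p m =>
    (integrableOn_bsplineWeight m).bdd_mul (c := 4 ^ p) (by fun_prop) (ae_of_all _ fun ξ => by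
      rw [Real.norm_of_nonneg (pow_nonneg (hu0 ξ) p)]
      exact pow_le_pow_left₀ (hu0 ξ) (hu4 ξ) p)
  have hnn : ∀ (p m : ℕ), 0 ≤ᵐ[volume.restrict (Set.Ioo (0 : ℝ) 1)]
      fun ξ => u ξ ^ p * bsplineWeight m ξ := fun p m =>
    ae_of_all _ fun ξ => mul_nonneg (pow_nonneg (hu0 ξ) p) (bsplineWeight_nonneg m ξ)
  set g : ℝ → ℝ := fun ξ => C ^ 2 * bsplineWeight (n + k) ξ - u ξ ^ k * bsplineWeight n ξ with hg
  have hgint : IntegrableOn g (Set.Icc 0 1) := by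
    rw [integrableOn_Icc_iff_integrableOn_Ioo]
    exact ((integrableOn_bsplineWeight (n + k)).const_mul _).sub (hint k n)
  have hpos : ∀ p : ℕ, 0 ≤ ∫ ξ in Set.Icc (0 : ℝ) 1, u ξ ^ p • g ξ := by
    intro p
    have h1 := h _ (finite_support_coeffDiff_iterate finite_support_unitCoeff p)
    have h2 := pow_le_pow_left' h1 2
    rw [mul_pow, eLpNorm_two_sq, eLpNorm_two_sq, ← Function.iterate_add_apply,
      lintegral_shiftSum_sq _ (finite_support_coeffDiff_iterate finite_support_unitCoeff _),
      lintegral_shiftSum_sq _ (finite_support_coeffDiff_iterate finite_support_unitCoeff _)] at h2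
    simp only [norm_symbol_coeffDiff_iterate finite_support_unitCoeff, symbol_unitCoeff, norm_one,
      one_pow, one_mul] at h2
    rw [← ofReal_integral_eq_lintegral_ofReal (hint _ _) (hnn _ _),
      ← ofReal_integral_eq_lintegral_ofReal (hint _ _) (hnn _ _), ← ENNReal.ofReal_pow hC,
      ← ENNReal.ofReal_mul (by positivity), ENNReal.ofReal_le_ofReal_iff
      (mul_nonneg (by positivity) (integral_nonneg_of_ae (hnn _ _)))] at h2
    rw [integral_Icc_eq_integral_Ioo]
    have e : ∀ ξ, u ξ ^ p • g ξ = C ^ 2 * (u ξ ^ p * bsplineWeight (n + k) ξ) -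
        u ξ ^ (k + p) * bsplineWeight n ξ := fun ξ => by
      simp only [hg, smul_eq_mul]
      ring
    simp only [e]
    rw [integral_sub ((hint _ _).const_mul _) (hint _ _), integral_const_mul]
    linarith
  have hhalf : u (1 / 2) = 4 := by
    simp only [hu]
    rw [show Real.pi * (1 / 2) = Real.pi / 2 by ring, Real.sin_pi_div_two]
    norm_num
  have hmax : ∀ y ∈ Set.Icc (0 : ℝ) 1, y ≠ 1 / 2 → u y < u (1 / 2) := by
    intro y hy hne
    rw [hhalf]
    have hcos : Real.cos (Real.pi * y) ≠ 0 := by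
      intro h0
      have h1 : Real.cos (Real.pi * y) = Real.cos (Real.pi / 2) := by
        rw [h0, Real.cos_pi_div_two]
      have h2 := Real.injOn_cos ⟨by nlinarith [Real.pi_pos, hy.1], by
        nlinarith [Real.pi_pos, hy.2]⟩ ⟨by linarith [Real.pi_pos], by linarith [Real.pi_pos]⟩ h1
      apply hne
      have : Real.pi * y = Real.pi * (1 / 2) := by rw [h2]; ring
      exact mul_left_cancel₀ Real.pi_ne_zero this
    have := Real.sin_sq_add_cos_sq (Real.pi * y)
    have : 0 < Real.cos (Real.pi * y) ^ 2 := by positivity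
    simp only [hu]
    linarith
  -- the peak functions `u ^ p / ∫ u ^ p` evaluate `g` at the midpoint in the limit
  have hgc : ContinuousWithinAt g (Set.Icc 0 1) (1 / 2) := by
    have hn : Set.Ioo (0 : ℝ) 1 ∈ 𝓝 (1 / 2 : ℝ) := isOpen_Ioo.mem_nhds (by norm_num)
    have c1 := (continuousOn_bsplineWeight (n + k)).continuousAt hn
    have c2 := (continuousOn_bsplineWeight n).continuousAt hn
    exact ((c1.const_mul _).sub ((huc.pow k).continuousAt.mul c2)).continuousWithinAt
  have hlim := tendsto_setIntegral_pow_smul_of_unique_maximum_of_isCompact_of_integrableOn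
    (μ := volume) isCompact_Icc huc.continuousOn hmax (fun x _ => hu0 x) (by rw [hhalf]; norm_num)
    (by
      rw [interior_Icc, closure_Ioo zero_ne_one]
      norm_num) hgint hgc
  have hge : 0 ≤ g (1 / 2) := ge_of_tendsto' hlim fun p => by
    refine mul_nonneg (inv_nonneg.2 (integral_nonneg fun x => pow_nonneg (hu0 x) p)) (hpos p)
  have hW := bsplineWeight_half_pos (n + k)
  have hK := bernsteinConst_one_sq n k
  have h4 : u (1 / 2) ^ k * bsplineWeight n (1 / 2) =
      bernsteinConst (n + k) k 1 ^ 2 * bsplineWeight (n + k) (1 / 2) := by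
    rw [hhalf, bsplineWeight, bsplineWeight, show Real.pi * (1 / 2) = Real.pi / 2 by ring,
      Real.sin_pi_div_two]
    have e : (1 ^ 2 / Real.pi ^ 2) ^ (n + 1) =
        (1 ^ 2 / Real.pi ^ 2) ^ (n + k + 1) * Real.pi ^ (2 * k) := by
      have hp : ((Real.pi ^ 2)⁻¹) ^ k * (Real.pi ^ 2) ^ k = 1 := by
        rw [← mul_pow, inv_mul_cancel₀ (pow_ne_zero 2 Real.pi_ne_zero), one_pow]
      rw [one_pow, one_div, pow_mul Real.pi, add_right_comm n k 1, pow_add _ (n + 1) k, mul_assoc,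
        hp, mul_one]
    rw [e]
    linear_combination (-(1 ^ 2 / Real.pi ^ 2) ^ (n + k + 1)) * hK
  simp only [hg] at hge
  rw [h4, ← sub_mul] at hge
  have h5 : bernsteinConst (n + k) k 1 ^ 2 ≤ C ^ 2 := by
    have := nonneg_of_mul_nonneg_left hge hW
    linarith
  exact (pow_le_pow_iff_left₀ (bernsteinConst_pos _ _ one_pos).le hC two_ne_zero).1 h5

/-! ### Scaling of the mesh -/

lemma iteratedDeriv_comp_mul (k : ℕ) (f : ℝ → ℝ) (a : ℝ) :
    iteratedDeriv k (fun x => f (a * x)) = fun x => a ^ k * iteratedDeriv k f (a * x) := by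
  induction k with
  | zero => simp
  | succ k ih =>
    funext x
    rw [iteratedDeriv_succ, ih, deriv_const_mul_field, iteratedDeriv_succ,
      deriv_comp_mul_left a (iteratedDeriv k f) x, smul_eq_mul, pow_succ, mul_assoc]

lemma eLpNorm_comp_mul (f : ℝ → ℝ) {a : ℝ} (ha : 0 < a) :
    eLpNorm (fun x => f (a * x)) 2 volume =
      ENNReal.ofReal a⁻¹ ^ (1 / 2 : ℝ) * eLpNorm f 2 volume := by
  have hemb : MeasurableEmbedding fun x : ℝ => a * x :=
    (Homeomorph.mulLeft₀ a ha.ne').measurableEmbedding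
  have h := hemb.eLpNorm_map_measure (g := f) (p := 2) (μ := volume)
  rw [Real.map_volume_mul_left ha.ne', abs_of_pos (inv_pos.2 ha),
    eLpNorm_smul_measure_of_ne_top (by norm_num)] at h
  rw [show (fun x => f (a * x)) = f ∘ fun x => a * x from rfl, ← h]
  simp

lemma ae_notMem_range_intCast : ∀ᵐ x : ℝ, x ∉ Set.range ((↑) : ℤ → ℝ) :=
  (Set.countable_range _).ae_notMem volume

lemma eLpNorm_iteratedDeriv_shiftSum_comp_mul {m k : ℕ} (hk : k ≤ m) (c : ℤ → ℝ) {a : ℝ}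
    (ha : 0 < a) : eLpNorm (iteratedDeriv k fun x => shiftSum m c (a * x)) 2 volume =
      ENNReal.ofReal (a ^ k) * (ENNReal.ofReal a⁻¹ ^ (1 / 2 : ℝ) *
        eLpNorm (shiftSum (m - k) (coeffDiff^[k] c)) 2 volume) := by
  have h1 : eLpNorm (shiftSum (m - k) (coeffDiff^[k] c)) 2 volume =
      eLpNorm (iteratedDeriv k (shiftSum m c)) 2 volume := by
    refine eLpNorm_congr_ae ?_
    filter_upwards [ae_notMem_range_intCast] with x hx
    exact (iteratedDeriv_shiftSum hk c hx).symm
  rw [iteratedDeriv_comp_mul, h1, ← eLpNorm_comp_mul _ ha]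
  have h2 := eLpNorm_const_smul (a ^ k) (fun x => iteratedDeriv k (shiftSum m c) (a * x)) 2
    (volume : Measure ℝ)
  rw [← ofReal_norm, Real.norm_of_nonneg (pow_nonneg ha.le k)] at h2
  exact h2

lemma exists_eq_shiftSum_of_mem_splineSpace {m : ℕ} {δ : ℝ} {s : ℝ → ℝ}
    (hs : s ∈ splineSpace m δ) : ∃ c, s = fun x => shiftSum m c (δ⁻¹ * x) := by
  obtain ⟨c, hc⟩ := hs.combination
  refine ⟨c, funext fun x => ?_⟩
  rw [hc x, shiftSum, inv_mul_eq_div]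

lemma eLpNorm_iteratedDeriv_le_of_mem_splineSpace {m k : ℕ} (hk : k ≤ m) {δ : ℝ} (hδ : 0 < δ)
    {s : ℝ → ℝ} (hs : s ∈ splineSpace m δ) : eLpNorm (iteratedDeriv k s) 2 volume ≤
      ENNReal.ofReal (bernsteinConst m k δ⁻¹) * eLpNorm s 2 volume := by
  obtain ⟨c, rfl⟩ := exists_eq_shiftSum_of_mem_splineSpace hs
  have hδ' := inv_pos.2 hδ
  rw [eLpNorm_iteratedDeriv_shiftSum_comp_mul hk c hδ', eLpNorm_comp_mul _ hδ',
    bernsteinConst_eq_mul, ENNReal.ofReal_mul (by positivity), mul_assoc]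
  refine mul_le_mul_right ?_ _
  rw [mul_left_comm]
  exact mul_le_mul_right (eLpNorm_shiftSum_coeffDiff_le hk c) _

/-! ### Sums of B-splines belong to the spline space -/

lemma hasDerivAt_truncPow_add_two (m : ℕ) (x : ℝ) :
    HasDerivAt (truncPow (m + 2)) ((m + 2 : ℕ) * truncPow (m + 1) x) x := by
  rcases ne_or_eq x 0 with hx | rfl
  · exact hasDerivAt_truncPow_succ (m + 1) hx
  · exact hasDerivAt_of_hasDerivAt_of_ne (g := fun x => (m + 2 : ℕ) * truncPow (m + 1) x)
      (fun y hy => hasDerivAt_truncPow_succ (m + 1) hy)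
      (continuous_truncPow_succ _).continuousAt
      ((continuous_truncPow_succ m).const_mul _).continuousAt

lemma contDiff_truncPow (r m : ℕ) (h : r < m) : ContDiff ℝ r (truncPow m) := by
  induction r generalizing m with
  | zero =>
    obtain ⟨m, rfl⟩ : ∃ j, m = j + 1 := ⟨m - 1, by omega⟩
    exact contDiff_zero.2 (continuous_truncPow_succ m)
  | succ r ih =>
    obtain ⟨m, rfl⟩ : ∃ j, m = j + 2 := ⟨m - 2, by omega⟩
    have hd : deriv (truncPow (m + 2)) = fun x => ((m + 2 : ℕ) : ℝ) * truncPow (m + 1) x :=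
      funext fun x => (hasDerivAt_truncPow_add_two m x).deriv
    rw [Nat.cast_succ, contDiff_succ_iff_deriv]
    refine ⟨fun x => (hasDerivAt_truncPow_add_two m x).differentiableAt, by simp, ?_⟩
    rw [hd]
    exact contDiff_const.mul (ih (m + 1) (by omega))

lemma contDiff_cardinalBSpline {r m : ℕ} (h : r < m) : ContDiff ℝ r (cardinalBSpline m) :=
  contDiff_const.mul (ContDiff.sum fun _ _ => contDiff_const.mul
    ((contDiff_truncPow r m h).comp (contDiff_id.sub contDiff_const)))

/-- The functions that agree with a polynomial of degree at most `m` on a set `I`. -/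
def polyFunctionsOn (m : ℕ) (I : Set ℝ) : Submodule ℝ (ℝ → ℝ) where
  carrier := {f | ∃ p : Polynomial ℝ, p.natDegree ≤ m ∧ ∀ x ∈ I, f x = p.eval x}
  zero_mem' := ⟨0, by simp⟩
  add_mem' := by
    rintro f g ⟨p, hp, hf⟩ ⟨q, hq, hg⟩
    exact ⟨p + q, Polynomial.natDegree_add_le_of_degree_le hp hq, fun x hx => by
      rw [Pi.add_apply, hf x hx, hg x hx, Polynomial.eval_add]⟩
  smul_mem' := by
    rintro a f ⟨p, hp, hf⟩
    exact ⟨a • p, (Polynomial.natDegree_smul_le a p).trans hp, fun x hx => by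
      rw [Pi.smul_apply, hf x hx, Polynomial.eval_smul]⟩

lemma truncPow_mem_polyFunctionsOn (m : ℕ) {δ : ℝ} (hδ : 0 < δ) (l j : ℤ) :
    (fun x => truncPow m (x / δ + j)) ∈
      polyFunctionsOn m (Set.Ioo (δ * ((l : ℝ) - 1)) (δ * l)) := by
  have hx : ∀ x ∈ Set.Ioo (δ * ((l : ℝ) - 1)) (δ * l), (l : ℝ) - 1 < x / δ ∧ x / δ < l :=
    fun x hx => ⟨by rw [lt_div_iff₀ hδ]; linarith [hx.1], by rw [div_lt_iff₀ hδ]; linarith [hx.2]⟩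
  rcases lt_or_ge 0 (l + j) with h | h
  · have h' : (1 : ℝ) ≤ l + j := by exact_mod_cast h
    refine ⟨(Polynomial.C δ⁻¹ * Polynomial.X + Polynomial.C (j : ℝ)) ^ m, ?_, fun x hxI => ?_⟩
    · refine (Polynomial.natDegree_pow_le).trans ?_
      calc m * _ ≤ m * 1 := Nat.mul_le_mul_left _ Polynomial.natDegree_linear_le
        _ = m := mul_one m
    · simp only
      rw [truncPow, if_pos (by linarith [(hx x hxI).1])]
      simp [div_eq_inv_mul]
  · have h' : (l : ℝ) + j ≤ 0 := by exact_mod_cast h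
    refine ⟨0, by simp, fun x hxI => ?_⟩
    simp only
    rw [truncPow, if_neg (by linarith [(hx x hxI).2])]
    simp

lemma shiftSum_mem_splineSpace (m : ℕ) {c : ℤ → ℝ} (hc : (Function.support c).Finite) {δ : ℝ}
    (hδ : 0 < δ) : (fun x => shiftSum m c (x / δ)) ∈ splineSpace m δ where
  combination := ⟨c, fun _ => rfl⟩
  piecewise l := by
    have key : (fun x => shiftSum m c (x / δ)) ∈
        polyFunctionsOn m (Set.Ioo (δ * ((l : ℝ) - 1)) (δ * l)) := by
      have e : (fun x => shiftSum m c (x / δ)) = ∑ γ ∈ hc.toFinset, c γ •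
          ((1 / (m.factorial : ℝ)) • ∑ j ∈ Finset.range (m + 2),
            ((-1 : ℝ) ^ j * ((m + 1).choose j : ℝ)) •
              fun x => truncPow m (x / δ + ((γ - j : ℤ) : ℝ))) := by
        funext x
        rw [shiftSum_eq_sum_support m hc, Finset.sum_apply]
        refine Finset.sum_congr rfl fun γ _ => ?_
        simp only [cardinalBSpline, Pi.smul_apply, Finset.sum_apply, smul_eq_mul]
        congr 2
        refine Finset.sum_congr rfl fun j _ => ?_
        congr 2
        push_cast
        ring
      rw [e]
      exact Submodule.sum_mem _ fun γ _ => Submodule.smul_mem _ _ (Submodule.smul_mem _ _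
        (Submodule.sum_mem _ fun j _ => Submodule.smul_mem _ _
          (truncPow_mem_polyFunctionsOn m hδ l _)))
    exact key
  smooth r hr := by
    rw [shiftSum_eq_sum_support m hc]
    refine ContDiff.sum fun γ _ => contDiff_const.mul ?_
    exact (contDiff_cardinalBSpline hr).comp ((contDiff_id.div_const δ).add contDiff_const)

theorem mainTheorem1 (m k : ℕ) (hk : k ≤ m) :
    (∀ h : ℝ, 0 < h →
      (∀ s ∈ splineSpace m (1 / h),
        eLpNorm (iteratedDeriv k s) 2 volume
          ≤ ENNReal.ofReal (bernsteinConst m k h) * eLpNorm s 2 volume) ∧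
      (∀ C : ℝ,
        (∀ s ∈ splineSpace m (1 / h), MemLp s 2 volume →
          eLpNorm (iteratedDeriv k s) 2 volume
            ≤ ENNReal.ofReal C * eLpNorm s 2 volume) →
        bernsteinConst m k h ≤ C)) ∧
    (∀ h : ℕ, 0 < h → ∀ s ∈ splineSpace m (h : ℝ),
      eLpNorm (iteratedDeriv k s) 2 volume
        ≤ ENNReal.ofReal (bernsteinConst m k h) * eLpNorm s 2 volume) := by
  refine ⟨fun h hh => ⟨fun s hs => ?_, fun C hC => ?_⟩, fun h hh s hs => ?_⟩
  · simpa using eLpNorm_iteratedDeriv_le_of_mem_splineSpace hk (one_div_pos.2 hh) hs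
  · have hhk : 0 < h ^ k := pow_pos hh k
    have key : bernsteinConst m k 1 ≤ max C 0 / h ^ k := by
      refine bernsteinConst_le_of_forall hk (by positivity) fun c hc => ?_
      have e : (fun x => shiftSum m c (x / (1 / h))) = fun x => shiftSum m c (h * x) := by
        funext x
        rw [div_div_eq_mul_div, div_one, mul_comm]
      have hmem := shiftSum_mem_splineSpace m hc (one_div_pos.2 hh)
      rw [e] at hmem
      have hκ0 : ENNReal.ofReal h⁻¹ ^ (1 / 2 : ℝ) ≠ 0 := by
        simpa using hh
      have hκt : ENNReal.ofReal h⁻¹ ^ (1 / 2 : ℝ) ≠ ⊤ :=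
        ENNReal.rpow_ne_top_of_nonneg (by norm_num) ENNReal.ofReal_ne_top
      have hLp : MemLp (fun x => shiftSum m c (h * x)) 2 volume := by
        refine ⟨((measurable_shiftSum m c).comp
          (measurable_const_mul h)).aestronglyMeasurable, ?_⟩
        rw [eLpNorm_comp_mul _ hh]
        exact ENNReal.mul_lt_top hκt.lt_top (memLp_shiftSum m hc 2).2
      have h1 := hC _ hmem hLp
      rw [eLpNorm_iteratedDeriv_shiftSum_comp_mul hk c hh, eLpNorm_comp_mul _ hh,
        mul_left_comm, mul_left_comm (ENNReal.ofReal C), ENNReal.mul_le_mul_iff_right hκ0 hκt] at h1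
      have hC' : ENNReal.ofReal C =
          ENNReal.ofReal (h ^ k) * ENNReal.ofReal (max C 0 / h ^ k) := by
        rw [← ENNReal.ofReal_mul hhk.le, mul_div_cancel₀ _ hhk.ne']
        rcases le_total 0 C with h0 | h0
        · rw [max_eq_left h0]
        · rw [max_eq_right h0, ENNReal.ofReal_of_nonpos h0, ENNReal.ofReal_zero]
      rw [hC', mul_assoc, ENNReal.mul_le_mul_iff_right (by simpa using hhk)
        ENNReal.ofReal_ne_top] at h1
      exact h1
    rw [le_div_iff₀ hhk, mul_comm, ← bernsteinConst_eq_mul] at key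
    -- the constant is positive, so it cannot be bounded by `0`
    exact (le_max_iff.1 key).resolve_right (not_le.2 (bernsteinConst_pos m k hh))
  · have h1 : (1 : ℝ) ≤ h := by exact_mod_cast hh
    refine (eLpNorm_iteratedDeriv_le_of_mem_splineSpace hk (by linarith) hs).trans
      (mul_le_mul_left (ENNReal.ofReal_le_ofReal ?_) _)
    -- on the mesh `h ≥ 1` the sharp constant has the factor `h⁻ᵏ ≤ hᵏ`
    rw [bernsteinConst_eq_mul, bernsteinConst_eq_mul m k h]
    refine mul_le_mul_of_nonneg_right ?_ (bernsteinConst_pos m k one_pos).le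
    have : (h : ℝ)⁻¹ ≤ h := (inv_le_one_of_one_le₀ h1).trans h1
    gcongr
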